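/- Let $(\Omega,\mathcal F,\mathbb P)$ be a probability space and $\theta:\Omega\to\Omega$ a bi-measurable, measure-preserving and ergodic bijection. Let $T:\Omega\times\mathbb R^d\to\Omega\times\mathbb R^d$, $T(\omega,x)=(\theta\omega,T_\omega(x))$, be a random $C^1$ map, that is, each $T_\omega$ is $C^1$ and $\omega\mapsto T_\omega(x)$ is measurable for each $x$. Put $T^n_\omega=T_{\theta^{n-1}\omega}\circ\dots\circ T_\omega$ and $\Phi_n(\omega,x)=\log\|DT^n_\omega(x)\|\in[-\infty,\infty)$. Let $K\subseteq\Omega\times\mathbb R^d$ be a random compact set: the fibres $K(\omega)=\{x:(\omega,x)\in K\}$ are compact for all $\omega$, and $\omega\mapsto d(x,K(\omega))\in[0,\infty]$ is measurable for all $x$ (with $d(x,\emptyset)=\infty$). Suppose that $K$ is $T$-invariant, i.e. $T_\omega(K(\omega))=K(\theta\omega)$ for $\mathbb P$-a.e. $\omega$, and that $\omega\mapsto\sup_{x\in K(\omega)}\log^+\|DT_\omega(x)\|$ is $\mathbb P$-integrable (the supremum over an empty fibre being $0$). Write $B_r(K(\omega))=\{x: d(x,K(\omega))<r\}$, and assume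 the uniform derivative condition in one of the following two forms (with $\sup\emptyset=-\infty$): (a) for all $k\ge1$ and $\varepsilon>0$ there is $r>0$ such that for all $\omega\in\Omega$ $$\sup_{x\in B_r(K(\omega))}\Phi_k(\omega,x)\le\sup_{x\in K(\omega)}\Phi_k(\omega,x)+\varepsilon;$$ (b) for all $k\ge1$ and $\varepsilon>0$ there is $r>0$ such that $$\sup\{\Phi_k(\omega,x):\omega\in\Omega,\ x\in B_r(K(\omega))\}\le\sup\{\Phi_k(\omega,x):\omega\in\Omega,\ x\in K(\omega)\}+\varepsilon,$$ and $\sup\{\Phi_1(\omega,x):\omega\in\Omega,\ x\in K(\omega)\}<\infty$. Let $\mathcal M^K_{\mathbb P}(T)$ be the set of $T$-invariant probability measures $\mu$ on $\Omega\times\mathbb R^d$ that project to $\mathbb P$ and satisfy $\mu(K)=1$, and let $\lambda(\mu,T)=\inf_{n\ge1}\frac1n\int\Phi_n\,d\mu\in[-\infty,\infty)$ be the maximal Lyapunov exponent of $\mu$. If $\lambda(\mu,T)<0$ for all $\mu\in\mathcal M^K_{\mathbb P}(T)$, then there is an integer $n\ge0$ such that $\#K(\omega)=n$ for $\mathbb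 P$-a.e. $\omega\in\Omega$. -/

import Mathlib

open MeasureTheory
open scoped ENNReal

namespace RandomMap

/-- The fibre `K(ω) = {x | (ω, x) ∈ K}`. -/
def fibre {Ω M : Type*} (K : Set (Ω × M)) (ω : Ω) : Set M := {x | (ω, x) ∈ K}

/-- The skew product `(ω, x) ↦ (θ ω, T_ω x)` on `Ω × M`. -/
def skew {Ω M : Type*} (θ : Ω → Ω) (T : Ω → M → M) : Ω × M → Ω × M :=
  fun p => (θ p.1, T p.1 p.2)

/-- The iterated fibre map `T_ω^n = T_{θ^{n-1} ω} ∘ ⋯ ∘ T_ω`. -/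
def iter {Ω M : Type*} (θ : Ω → Ω) (T : Ω → M → M) : ℕ → Ω → M → M
  | 0, _, x => x
  | n + 1, ω, x => T (θ^[n] ω) (iter θ T n ω x)

/-- The fibre maps `T_ω` of a random `C¹` map of `ℝ^d`: every `T_ω` is continuously
differentiable, and `ω ↦ T_ω x` is measurable for every `x`. -/
structure IsRandomC1 {Ω : Type*} [MeasurableSpace Ω] {d : ℕ}
    (T : Ω → EuclideanSpace ℝ (Fin d) → EuclideanSpace ℝ (Fin d)) : Prop where
  contDiff : ∀ ω, ContDiff ℝ 1 (T ω)
  measurable : ∀ x, Measurable fun ω => T ω x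

/-- Random compact sets. The distance takes values in `[0, ∞]`, with `d(x, ∅) = ∞`. -/
structure IsRandomCompact {Ω : Type*} [MeasurableSpace Ω] {M : Type*} [PseudoEMetricSpace M]
    (K : Set (Ω × M)) : Prop where
  isCompact : ∀ ω, IsCompact (fibre K ω)
  measurable : ∀ x, Measurable fun ω => Metric.infEDist x (fibre K ω)

/-- `K` is `T`-invariant: `T_ω(K(ω)) = K(θ ω)` for almost every `ω`. -/
def IsInvariant {Ω : Type*} [MeasurableSpace Ω] {M : Type*} (P : Measure Ω) (θ : Ω → Ω)
    (T : Ω → M → M) (K : Set (Ω × M)) : Prop :=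
  ∀ᵐ ω ∂P, T ω '' fibre K ω = fibre K (θ ω)

/-- `Φ_n(ω, x) = log ‖D T_ω^n(x)‖ ∈ [-∞, ∞)`, with `log 0 = -∞`. -/
noncomputable def logNormDeriv {Ω : Type*} {d : ℕ} (θ : Ω → Ω)
    (T : Ω → EuclideanSpace ℝ (Fin d) → EuclideanSpace ℝ (Fin d)) (n : ℕ)
    (p : Ω × EuclideanSpace ℝ (Fin d)) : EReal :=
  ENNReal.log ‖fderiv ℝ (iter θ T n p.1) p.2‖ₑ

/-- The integral `∫ f⁺ dμ - ∫ f⁻ dμ ∈ [-∞, ∞]` of an extended real valued function; it is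
meaningful when one of the two terms is finite. -/
noncomputable def extIntegral {X : Type*} [MeasurableSpace X] (μ : Measure X) (f : X → EReal) :
    EReal :=
  ((∫⁻ x, (f x).toENNReal ∂μ : ℝ≥0∞) : EReal) - ((∫⁻ x, (-f x).toENNReal ∂μ : ℝ≥0∞) : EReal)

/-- The maximal Lyapunov exponent `λ(μ, T) = inf_{n ≥ 1} (1/n) ∫ log ‖D T_ω^n(x)‖ dμ(ω, x)`.
(By subadditivity this infimum is also the limit as `n → ∞` when `μ` is invariant and
`log⁺ ‖D T_ω(x)‖` is `μ`-integrable.) -/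
noncomputable def lyapunov {Ω : Type*} [MeasurableSpace Ω] {d : ℕ} (θ : Ω → Ω)
    (T : Ω → EuclideanSpace ℝ (Fin d) → EuclideanSpace ℝ (Fin d))
    (μ : Measure (Ω × EuclideanSpace ℝ (Fin d))) : EReal :=
  ⨅ n : ℕ, ⨅ _ : 1 ≤ n, extIntegral μ (logNormDeriv θ T n) / (n : EReal)

/-- The set `M_P^K(T)` of the `T`-invariant probability measures on `Ω × M` that project to `P`
and are supported on `K`. -/
def invariantMeasures {Ω M : Type*} [MeasurableSpace Ω] [MeasurableSpace M] (P : Measure Ω)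
    (θ : Ω → Ω) (T : Ω → M → M) (K : Set (Ω × M)) : Set (Measure (Ω × M)) :=
  {μ | IsProbabilityMeasure μ ∧ MeasurePreserving (skew θ T) μ μ ∧ μ.map Prod.fst = P ∧ μ Kᶜ = 0}

/-- The uniform derivative condition, fibre by fibre: for all `k ≥ 1` and `ε > 0` there is `r > 0`
with `sup_{B_r(K(ω))} Φ_k(ω, ·) ≤ sup_{K(ω)} Φ_k(ω, ·) + ε` for all `ω`. -/
def FibrewiseUniform {Ω : Type*} {d : ℕ} (θ : Ω → Ω)
    (T : Ω → EuclideanSpace ℝ (Fin d) → EuclideanSpace ℝ (Fin d))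
    (K : Set (Ω × EuclideanSpace ℝ (Fin d))) : Prop :=
  ∀ k : ℕ, 1 ≤ k → ∀ ε : ℝ, 0 < ε → ∃ r : ℝ, 0 < r ∧ ∀ ω,
    (⨆ x ∈ Metric.thickening r (fibre K ω), logNormDeriv θ T k (ω, x)) ≤
      (⨆ x ∈ fibre K ω, logNormDeriv θ T k (ω, x)) + (ε : EReal)

/-- The uniform derivative condition with suprema over all fibres at once: for all `k ≥ 1` and
`ε > 0` there is `r > 0` with
`sup {Φ_k(ω, x) | ω ∈ Ω, x ∈ B_r(K(ω))} ≤ sup {Φ_k(ω, x) | ω ∈ Ω, x ∈ K(ω)} + ε`. -/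
def GlobalUniform {Ω : Type*} {d : ℕ} (θ : Ω → Ω)
    (T : Ω → EuclideanSpace ℝ (Fin d) → EuclideanSpace ℝ (Fin d))
    (K : Set (Ω × EuclideanSpace ℝ (Fin d))) : Prop :=
  ∀ k : ℕ, 1 ≤ k → ∀ ε : ℝ, 0 < ε → ∃ r : ℝ, 0 < r ∧
    (⨆ ω, ⨆ x ∈ Metric.thickening r (fibre K ω), logNormDeriv θ T k (ω, x)) ≤
      (⨆ ω, ⨆ x ∈ fibre K ω, logNormDeriv θ T k (ω, x)) + (ε : EReal)

/-- The uniform derivative condition: it holds fibre by fibre, or else with suprema over all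
fibres at once, where the derivative is bounded on `K` (if `sup_K Φ_1 = ∞`, the second inequality
can be void). -/
def UniformDerivativeCondition {Ω : Type*} {d : ℕ} (θ : Ω → Ω)
    (T : Ω → EuclideanSpace ℝ (Fin d) → EuclideanSpace ℝ (Fin d))
    (K : Set (Ω × EuclideanSpace ℝ (Fin d))) : Prop :=
  FibrewiseUniform θ T K ∨
    (GlobalUniform θ T K ∧ (⨆ ω, ⨆ x ∈ fibre K ω, logNormDeriv θ T 1 (ω, x)) < ⊤)

end RandomMap

/-! The proof turns on the mean supremum `meanSup P K f`, the integral over the base of the supremum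
of `f` on `K(ω)`. It is a sublinear functional on the random continuous functions with an integrable
bound on `K`. It is applied to the functions `truncLogDeriv θ T m k`, that is `log ‖DT^k‖` cut off
below at `-k m`: these are real valued and still subadditive in `k`.

Suppose first that all these mean suprema are nonnegative for `k ≥ 1`. Hahn–Banach gives linear
functionals below `meanSup` that attain it at longer and longer times and lower and lower cut-offs.
An ultrafilter limit of their orbit averages is invariant and, by subadditivity, nonnegative on
every truncation (`exists_invariant_linearMap`). The Daniell–Stone theorem makes it a measure, and
domination by `meanSup` forces the marginal `P` and the support `K`
(`exists_mem_invariantMeasures`). Monotone convergence removes the cut-off, so this invariant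
measure has a nonnegative exponent, a contradiction.

Hence some mean supremum is negative. The uniform derivative condition allows suprema over
`r`-neighbourhoods of the fibres instead (`exists_thickening_bound`). By the maximal ergodic theorem
there is an event of positive probability on which the Birkhoff sums of the resulting bound are at
most `-nε`; there `T^{kn}` brings all points of `K(ω)` closer than `r` within `r e^{-nε}` of each
other (`exists_not_ae_le_encard_of_bound`). By compactness, for some `N` the fibre `K(ω)` moreover
has, with positive probability, no `N` points at mutual distances at least `r`. Then `K(θ^{kn} ω)`
has no `N` points further than `r e^{-nε}` apart, with a probability bounded below because `θ`
preserves `P`. Letting `n → ∞`, fibres have fewer than `N` points with positive probability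
(`exists_not_ae_le_encard`). The cardinality cannot increase along `θ`, so ergodicity makes it
constant (`exists_ae_encard_eq`). -/

namespace RandomMap

/-! ### The Daniell–Stone theorem, by areas of regions between graphs. -/

section Daniell

open Set Filter Topology

variable {α : Type*}

/-- The region `{(z, t) | f z < t ≤ g z}` between two graphs. -/
def between (f g : α → ℝ) : Set (α × ℝ) := {p | f p.1 < p.2 ∧ p.2 ≤ g p.1}

/-- The regions between the graphs of two functions of `L`. -/
def betweenSets (L : Submodule ℝ (α → ℝ)) : Set (Set (α × ℝ)) :=
  {S | ∃ f ∈ L, ∃ g ∈ L, f ≤ g ∧ S = between f g}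

/-- The length of the vertical sections of a subset of `α × ℝ`. -/
noncomputable def sectionLength (S : Set (α × ℝ)) (z : α) : ℝ :=
  (volume (Prod.mk z ⁻¹' S)).toReal

lemma preimage_between (f g : α → ℝ) (z : α) : Prod.mk z ⁻¹' between f g = Ioc (f z) (g z) := rfl

lemma sectionLength_between {f g : α → ℝ} (h : f ≤ g) : sectionLength (between f g) = g - f := by
  ext z
  simp [sectionLength, preimage_between, Real.volume_Ioc, h z]

variable {L : Submodule ℝ (α → ℝ)}

lemma inf_mem_of_sup_mem (hsup : ∀ f ∈ L, ∀ g ∈ L, f ⊔ g ∈ L) {f g : α → ℝ} (hf : f ∈ L)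
    (hg : g ∈ L) : f ⊓ g ∈ L := by
  have : f ⊓ g = -(-f ⊔ -g) := by simp [neg_sup]
  rw [this]
  exact L.neg_mem (hsup _ (L.neg_mem hf) _ (L.neg_mem hg))

lemma between_mem (hsup : ∀ f ∈ L, ∀ g ∈ L, f ⊔ g ∈ L) {f g : α → ℝ} (hf : f ∈ L) (hg : g ∈ L) :
    between f g ∈ betweenSets L := by
  refine ⟨f, hf, f ⊔ g, hsup _ hf _ hg, le_sup_left, ?_⟩
  ext ⟨z, t⟩
  simp only [between, mem_ofPred_eq, Pi.sup_apply, le_sup_iff]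
  grind

/-- Removing the region between `f'` and `g'` leaves the part below `f'` and the part above `g'`;
they are disjoint because `f' ≤ g'`. -/
lemma isSetSemiring_betweenSets (hsup : ∀ f ∈ L, ∀ g ∈ L, f ⊔ g ∈ L) :
    IsSetSemiring (betweenSets L) where
  empty_mem := ⟨0, L.zero_mem, 0, L.zero_mem, le_rfl, by
    ext p; simp only [between, mem_ofPred_eq, mem_empty_iff_false, Pi.zero_apply]; grind⟩
  inter_mem := by
    rintro _ ⟨f, hf, g, hg, -, rfl⟩ _ ⟨f', hf', g', hg', -, rfl⟩
    convert between_mem hsup (hsup _ hf _ hf') (inf_mem_of_sup_mem hsup hg hg') using 1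
    ext p
    simp only [between, mem_inter_iff, mem_ofPred_eq, Pi.sup_apply, Pi.inf_apply, sup_lt_iff,
      le_inf_iff]
    tauto
  sdiff_eq_sUnion' := by
    classical
    rintro _ ⟨f, hf, g, hg, -, rfl⟩ _ ⟨f', hf', g', hg', h', rfl⟩
    refine ⟨{between f (g ⊓ f'), between (f ⊔ g') g}, ?_, ?_, ?_⟩
    · simp only [Finset.coe_insert, Finset.coe_singleton, insert_subset_iff, singleton_subset_iff]
      exact ⟨between_mem hsup hf (inf_mem_of_sup_mem hsup hg hf'),
        between_mem hsup (hsup _ hf _ hg') hg⟩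
    · simp only [Finset.coe_insert, Finset.coe_singleton]
      refine Set.pairwise_pair_of_symm.2 fun _ => ?_
      refine Set.disjoint_left.2 fun p hp hq => ?_
      have := h' p.1
      simp only [id, between, mem_ofPred_eq, Pi.sup_apply, Pi.inf_apply, sup_lt_iff,
        le_inf_iff] at hp hq
      linarith
    · ext p
      have := h' p.1
      simp only [between, Set.mem_sdiff, mem_ofPred_eq, Finset.coe_insert, Finset.coe_singleton,
        sUnion_insert, sUnion_singleton, mem_union, Pi.sup_apply, Pi.inf_apply, sup_lt_iff,
        le_inf_iff]
      grind

lemma measurableSet_section {S : Set (α × ℝ)} (hS : S ∈ betweenSets L) (z : α) :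
    MeasurableSet (Prod.mk z ⁻¹' S) := by
  obtain ⟨f, -, g, -, -, rfl⟩ := hS
  rw [preimage_between]; exact measurableSet_Ioc

lemma volume_section_ne_top {S : Set (α × ℝ)} (hS : S ∈ betweenSets L) (z : α) :
    volume (Prod.mk z ⁻¹' S) ≠ ∞ := by
  obtain ⟨f, -, g, -, -, rfl⟩ := hS
  rw [preimage_between]; simp

lemma sectionLength_mem {S : Set (α × ℝ)} (hS : S ∈ betweenSets L) : sectionLength S ∈ L := by
  obtain ⟨f, hf, g, hg, h, rfl⟩ := hS
  rw [sectionLength_between h]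
  exact L.sub_mem hg hf

lemma sectionLength_nonneg (S : Set (α × ℝ)) : 0 ≤ sectionLength S := fun _ =>
  ENNReal.toReal_nonneg

/-- The content on the regions between graphs that a positive functional defines. -/
noncomputable def daniellContent (ℓ : (α → ℝ) →ₗ[ℝ] ℝ) (hpos : ∀ f ∈ L, 0 ≤ f → 0 ≤ ℓ f) :
    AddContent ℝ≥0∞ (betweenSets L) where
  toFun S := ENNReal.ofReal (ℓ (sectionLength S))
  empty' := by
    have : sectionLength (∅ : Set (α × ℝ)) = 0 := by ext z; simp [sectionLength]
    simp [this]
  sUnion' I hI hd _ := by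
    have : sectionLength (⋃₀ (I : Set (Set (α × ℝ)))) = ∑ u ∈ I, sectionLength u := by
      ext z
      rw [Finset.sum_apply]
      unfold sectionLength
      rw [← ENNReal.toReal_sum fun u hu => volume_section_ne_top (hI hu) z,
        ← measure_biUnion_finset ?_ fun u hu => measurableSet_section (hI hu) z, sUnion_eq_biUnion]
      · simp
      · intro u hu v hv huv
        exact (hd hu hv huv).preimage _
    rw [this, map_sum, ENNReal.ofReal_sum_of_nonneg]
    exact fun u hu => hpos _ (sectionLength_mem (hI hu)) (sectionLength_nonneg u)

lemma daniellContent_apply (ℓ : (α → ℝ) →ₗ[ℝ] ℝ) (hpos : ∀ f ∈ L, 0 ≤ f → 0 ≤ ℓ f)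
    (S : Set (α × ℝ)) : daniellContent ℓ hpos S = ENNReal.ofReal (ℓ (sectionLength S)) := rfl

/-- The positive part of the total section length minus the partial sums decreases pointwise to
zero, by countable subadditivity of Lebesgue measure on each section. Continuity of the functional
makes this remainder vanish. -/
lemma daniellContent_isSigmaSubadditive (hsup : ∀ f ∈ L, ∀ g ∈ L, f ⊔ g ∈ L)
    (ℓ : (α → ℝ) →ₗ[ℝ] ℝ) (hpos : ∀ f ∈ L, 0 ≤ f → 0 ≤ ℓ f)
    (hcont : ∀ f : ℕ → α → ℝ, (∀ n, f n ∈ L) → Antitone f →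
      (∀ z, Tendsto (fun n => f n z) atTop (𝓝 0)) → Tendsto (fun n => ℓ (f n)) atTop (𝓝 0)) :
    (daniellContent ℓ hpos).IsSigmaSubadditive := by
  intro S hS hU
  have hmono : ∀ f ∈ L, ∀ g ∈ L, f ≤ g → ℓ f ≤ ℓ g := fun f hf g hg h => by
    have := hpos _ (L.sub_mem hg hf) (sub_nonneg.2 h)
    rwa [map_sub, sub_nonneg] at this
  set u := sectionLength (⋃ i, S i)
  have hu : u ∈ L := sectionLength_mem hU
  let h : ℕ → α → ℝ := fun n => (u - ∑ i ∈ Finset.range n, sectionLength (S i)) ⊔ 0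
  have hsum : ∀ n, ∑ i ∈ Finset.range n, sectionLength (S i) ∈ L := fun n =>
    L.sum_mem fun i _ => sectionLength_mem (hS i)
  have hL : ∀ n, h n ∈ L := fun n => hsup _ (L.sub_mem hu (hsum n)) _ L.zero_mem
  have hanti : Antitone h := antitone_nat_of_succ_le fun n => by
    refine sup_le_sup_right (sub_le_sub_left ?_ _) _
    rw [Finset.sum_range_succ]
    exact le_add_of_nonneg_right (sectionLength_nonneg _)
  have hlim : ∀ z, Tendsto (fun n => h n z) atTop (𝓝 0) := by
    intro z
    have h1 : Tendsto (fun n => volume (Prod.mk z ⁻¹' (⋃ i, S i)) -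
        ∑ i ∈ Finset.range n, volume (Prod.mk z ⁻¹' S i)) atTop (𝓝 0) := by
      have h2 := ENNReal.Tendsto.sub (tendsto_const_nhds (x := volume (Prod.mk z ⁻¹' (⋃ i, S i))))
        (ENNReal.tendsto_nat_tsum fun i => volume (Prod.mk z ⁻¹' S i))
        (Or.inl (volume_section_ne_top hU z))
      rwa [tsub_eq_zero_of_le] at h2
      rw [preimage_iUnion]
      exact measure_iUnion_le _
    have h3 := (ENNReal.tendsto_toReal ENNReal.zero_ne_top).comp h1
    refine h3.congr fun n => ?_
    simp only [Function.comp_apply, h, Pi.sup_apply, Pi.sub_apply, Pi.zero_apply, Finset.sum_apply,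
      u, sectionLength]
    rw [← ENNReal.toReal_sum fun i _ => volume_section_ne_top (hS i) z]
    set A := volume (Prod.mk z ⁻¹' (⋃ i, S i))
    set B := ∑ i ∈ Finset.range n, volume (Prod.mk z ⁻¹' S i)
    have hA : A ≠ ∞ := volume_section_ne_top hU z
    have hB : B ≠ ∞ := ENNReal.sum_ne_top.2 fun i _ => volume_section_ne_top (hS i) z
    rcases le_total A B with hAB | hAB
    · rw [tsub_eq_zero_of_le hAB, ENNReal.toReal_zero, max_eq_right]
      exact sub_nonpos.2 (ENNReal.toReal_mono hB hAB)
    · rw [ENNReal.toReal_sub_of_le hAB hA, max_eq_left]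
      exact sub_nonneg.2 (ENNReal.toReal_mono hA hAB)
  have hl := hcont h hL hanti hlim
  simp only [daniellContent_apply]
  have key : ∀ n, ENNReal.ofReal (ℓ u) ≤ ENNReal.ofReal (ℓ (h n)) +
      ∑' i, ENNReal.ofReal (ℓ (sectionLength (S i))) := by
    intro n
    have h1 : ℓ u ≤ ℓ (h n) + ∑ i ∈ Finset.range n, ℓ (sectionLength (S i)) := by
      rw [← map_sum, ← map_add]
      refine hmono _ hu _ (L.add_mem (hL n) (hsum n)) ?_
      rw [← sub_le_iff_le_add]
      exact le_sup_left
    refine (ENNReal.ofReal_le_ofReal h1).trans (ENNReal.ofReal_add_le.trans ?_)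
    gcongr
    rw [ENNReal.ofReal_sum_of_nonneg fun i _ =>
      hpos _ (sectionLength_mem (hS i)) (sectionLength_nonneg _)]
    exact ENNReal.sum_le_tsum _
  have hlim2 : Tendsto (fun n => ENNReal.ofReal (ℓ (h n)) +
      ∑' i, ENNReal.ofReal (ℓ (sectionLength (S i)))) atTop
      (𝓝 (0 + ∑' i, ENNReal.ofReal (ℓ (sectionLength (S i))))) := by
    refine Tendsto.add ?_ tendsto_const_nhds
    simpa using ENNReal.tendsto_ofReal hl
  rw [zero_add] at hlim2
  exact ge_of_tendsto' hlim2 key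

/-- The cylinder over `{f > 0}` is exhausted by regions of bottom `-m` and height `n f⁺`:
arbitrarily large multiples of `f⁺` reach every level exactly where `f > 0`. -/
lemma measurableSpace_prod_eq_generateFrom_betweenSets [mα : MeasurableSpace α]
    (hone : (1 : α → ℝ) ∈ L) (hsup : ∀ f ∈ L, ∀ g ∈ L, f ⊔ g ∈ L)
    (hmeas : ∀ f ∈ L, Measurable f)
    (hgen : mα ≤ MeasurableSpace.generateFrom {s | ∃ f ∈ L, s = {z | 0 < f z}}) :
    Prod.instMeasurableSpace (α := α) (β := ℝ) = MeasurableSpace.generateFrom (betweenSets L) := by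
  have hconst : ∀ c : ℝ, (fun _ => c : α → ℝ) ∈ L := fun c => by
    have h := L.smul_mem c hone
    convert h using 1
    ext z
    simp
  apply le_antisymm
  · have hU : ∀ f ∈ L, ∀ g ∈ L, MeasurableSet[.generateFrom (betweenSets L)] (between f g) :=
      fun f hf g hg => MeasurableSpace.measurableSet_generateFrom (between_mem hsup hf hg)
    refine sup_le ?_ ?_
    · rw [MeasurableSpace.comap_le_iff_le_map]
      refine hgen.trans (MeasurableSpace.generateFrom_le ?_)
      rintro _ ⟨f, hf, rfl⟩
      change MeasurableSet[.generateFrom (betweenSets L)] _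
      have : Prod.fst ⁻¹' {z | 0 < f z} = ⋃ m : ℕ, ⋃ n : ℕ,
          between (fun _ => -(m : ℝ)) ((fun _ => -(m : ℝ)) + (n : ℝ) • (f ⊔ 0)) := by
        ext ⟨z, t⟩
        simp only [mem_preimage, mem_ofPred_eq, mem_iUnion, between, Pi.add_apply, Pi.smul_apply,
          Pi.sup_apply, Pi.zero_apply, smul_eq_mul]
        constructor
        · intro hz
          obtain ⟨m, hm⟩ := exists_nat_gt (-t)
          obtain ⟨n, hn⟩ := exists_nat_gt ((t + m) / f z)
          refine ⟨m, n, by linarith, ?_⟩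
          rw [div_lt_iff₀ hz] at hn
          rw [max_eq_left hz.le]
          linarith
        · rintro ⟨m, n, h1, h2⟩
          by_contra hz
          rw [max_eq_right (not_lt.1 hz)] at h2
          linarith
      rw [this]
      refine MeasurableSet.iUnion fun m => MeasurableSet.iUnion fun n => hU _ (hconst _) _ ?_
      exact L.add_mem (hconst _) (L.smul_mem _ (hsup _ hf _ L.zero_mem))
    · have hb : Real.measurableSpace = .generateFrom (range Ioi) := borel_eq_generateFrom_Ioi ℝ
      rw [MeasurableSpace.comap_le_iff_le_map, hb]
      refine MeasurableSpace.generateFrom_le ?_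
      rintro _ ⟨c, rfl⟩
      change MeasurableSet[.generateFrom (betweenSets L)] _
      have : (Prod.snd ⁻¹' Ioi c : Set (α × ℝ)) = ⋃ n : ℕ,
          between (fun _ => c) (fun _ => (n : ℝ)) := by
        ext ⟨z, t⟩
        simp only [mem_preimage, mem_Ioi, mem_iUnion, between, mem_ofPred_eq, exists_and_left]
        exact ⟨fun h => ⟨h, exists_nat_ge t⟩, fun h => h.1⟩
      rw [this]
      exact MeasurableSet.iUnion fun n => hU _ (hconst _) _ (hconst _)
  · refine MeasurableSpace.generateFrom_le ?_
    rintro _ ⟨f, hf, g, hg, -, rfl⟩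
    exact (measurableSet_lt ((hmeas f hf).comp measurable_fst) measurable_snd).inter
      (measurableSet_le measurable_snd ((hmeas g hg).comp measurable_fst))

/-- **Daniell–Stone theorem**: a positive functional on a vector lattice of functions which
contains the constants, continuous along sequences decreasing to zero, is the integral
with respect to a finite measure. -/
theorem exists_measure_of_positive_functional [mα : MeasurableSpace α]
    (hone : (1 : α → ℝ) ∈ L) (hsup : ∀ f ∈ L, ∀ g ∈ L, f ⊔ g ∈ L)
    (hmeas : ∀ f ∈ L, Measurable f)
    (hgen : mα ≤ MeasurableSpace.generateFrom {s | ∃ f ∈ L, s = {z | 0 < f z}})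
    (ℓ : (α → ℝ) →ₗ[ℝ] ℝ) (hpos : ∀ f ∈ L, 0 ≤ f → 0 ≤ ℓ f)
    (hcont : ∀ f : ℕ → α → ℝ, (∀ n, f n ∈ L) → Antitone f →
      (∀ z, Tendsto (fun n => f n z) atTop (𝓝 0)) → Tendsto (fun n => ℓ (f n)) atTop (𝓝 0)) :
    ∃ μ : Measure α, IsFiniteMeasure μ ∧ ∀ f ∈ L, Integrable f μ ∧ ∫ z, f z ∂μ = ℓ f := by
  have hconst : ∀ c : ℝ, (fun _ => c : α → ℝ) ∈ L := fun c => by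
    have h := L.smul_mem c hone
    convert h using 1
    ext z
    simp
  have hC := isSetSemiring_betweenSets hsup
  have hσ := daniellContent_isSigmaSubadditive hsup ℓ hpos hcont
  have hgen' := measurableSpace_prod_eq_generateFrom_betweenSets hone hsup hmeas hgen
  set m : Measure (α × ℝ) := (daniellContent ℓ hpos).measure hC hgen'.le hσ with hm_def
  have hm : ∀ f ∈ L, ∀ g ∈ L, f ≤ g → m (between f g) = ENNReal.ofReal (ℓ (g - f)) := by
    intro f hf g hg h
    rw [hm_def, AddContent.measure_eq _ hC hgen' hσ (between_mem hsup hf hg),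
      daniellContent_apply, sectionLength_between h]
  have hIoc : ∀ a b : ℝ, (univ ×ˢ Ioc a b : Set (α × ℝ)) = between (fun _ => a) (fun _ => b) := by
    intro a b; ext p; simp [between]
  have hfin : ∀ a b : ℝ, m (univ ×ˢ Ioc a b) ≠ ∞ := by
    intro a b
    rcases le_total a b with hab | hab
    · rw [hIoc, hm _ (hconst a) _ (hconst b) fun _ => hab]; exact ENNReal.ofReal_ne_top
    · simp [Ioc_eq_empty_of_le hab]
  -- The content of a region depends only on `g - f`, hence is unchanged by vertical translations.
  -- This makes `m` a product with Lebesgue measure.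
  have htrans : ∀ c : ℝ, m.map (Prod.map id (c + ·)) = m := by
    intro c
    have hmc : Measurable (Prod.map id (c + ·) : α × ℝ → α × ℝ) :=
      measurable_id.prodMap (measurable_const_add c)
    have hval : ∀ f ∈ L, ∀ g ∈ L, f ≤ g →
        m.map (Prod.map id (c + ·)) (between f g) = m (between f g) := by
      intro f hf g hg h
      have hms : MeasurableSet (between f g) := by
        rw [hgen']; exact MeasurableSpace.measurableSet_generateFrom (between_mem hsup hf hg)
      rw [Measure.map_apply hmc hms]
      have : Prod.map id (c + ·) ⁻¹' between f g
          = between (f - fun _ => c) (g - fun _ => c) := by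
        ext p
        simp only [between, mem_preimage, mem_ofPred_eq, Prod.map_fst, Prod.map_snd, id,
          Pi.sub_apply]
        constructor <;> rintro ⟨h1, h2⟩ <;> constructor <;> linarith
      rw [this, hm _ (L.sub_mem hf (hconst c)) _ (L.sub_mem hg (hconst c)) (sub_le_sub_right h _),
        hm _ hf _ hg h, sub_sub_sub_cancel_right]
    refine Measure.ext_of_generateFrom_of_iUnion (betweenSets L)
      (fun n : ℕ => between (fun _ => -(n : ℝ)) (fun _ => (n : ℝ))) hgen'
      (fun s hs t ht _ => hC.inter_mem s hs t ht) ?_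
      (fun n => between_mem hsup (hconst _) (hconst _)) (fun n => ?_) ?_
    · refine eq_univ_of_forall fun p => mem_iUnion.2 ?_
      obtain ⟨n, hn⟩ := exists_nat_gt |p.2|
      exact ⟨n, (abs_lt.1 hn).1, (abs_lt.1 hn).2.le⟩
    · rw [hval _ (hconst _) _ (hconst _) fun _ => by
        have : (0 : ℝ) ≤ n := n.cast_nonneg
        linarith, ← hIoc]
      exact hfin _ _
    · rintro _ ⟨f, hf, g, hg, h, rfl⟩
      exact hval f hf g hg h
  -- The base measure is read off from a slab of height one.
  let μ : Measure α := (m.restrict (univ ×ˢ Ioc 0 1)).map Prod.fst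
  have hμ : ∀ s, MeasurableSet s → μ s = m (s ×ˢ Ioc 0 1) := by
    intro s hs
    rw [Measure.map_apply measurable_fst hs, Measure.restrict_apply (measurable_fst hs)]
    congr 1
    ext p; simp
  have hμfin : IsFiniteMeasure μ := ⟨by rw [hμ _ .univ]; exact (hfin 0 1).lt_top⟩
  have hprod : μ.prod volume = m := by
    refine Measure.prod_eq fun s t hs ht => ?_
    -- For a fixed base set, the mass as a function of the vertical set is a translation invariant
    -- measure, so it is a multiple of Lebesgue measure; the factor is found on `(0, 1]`.
    let ν : Measure ℝ := (m.restrict (s ×ˢ univ)).map Prod.snd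
    have hν : ∀ t, MeasurableSet t → ν t = m (s ×ˢ t) := by
      intro t ht
      rw [Measure.map_apply measurable_snd ht, Measure.restrict_apply (measurable_snd ht)]
      congr 1
      ext p; simp [and_comm]
    have hinv : ν.IsAddLeftInvariant := ⟨fun c => by
      ext t ht
      rw [Measure.map_apply (measurable_const_add c) ht, hν _ (measurable_const_add c ht), hν _ ht]
      conv_rhs => rw [← htrans c]
      rw [Measure.map_apply (measurable_id.prodMap (measurable_const_add c)) (hs.prod ht)]
      rfl⟩
    have hfc : IsFiniteMeasureOnCompacts ν := ⟨fun k hk => by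
      obtain ⟨r, hr⟩ := hk.isBounded.subset_closedBall 0
      refine (measure_mono (hr.trans ?_ : k ⊆ Ioc (-r - 1) r)).trans_lt ?_
      · intro x hx
        rw [Metric.mem_closedBall, Real.dist_0_eq_abs, abs_le] at hx
        constructor <;> linarith
      · rw [hν _ measurableSet_Ioc]
        exact (measure_mono (prod_mono_left (subset_univ s))).trans_lt (hfin _ _).lt_top⟩
    have h := Measure.isAddLeftInvariant_eq_smul ν volume
    have h1 : ν (Ioc 0 1) = Measure.addHaarScalarFactor ν volume := by
      conv_lhs => rw [h]
      rw [Measure.smul_apply, Real.volume_Ioc, sub_zero, ENNReal.ofReal_one, ENNReal.smul_def,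
        smul_eq_mul, mul_one]
    rw [← hν t ht, hμ s hs, ← hν _ measurableSet_Ioc, h1]
    conv_lhs => rw [h]
    rfl
  -- The region under the graph of `f` has content `ℓ f`, and by Fubini its product measure is the
  -- integral of `f`.
  have hlint : ∀ f ∈ L, 0 ≤ f → ∫⁻ z, ENNReal.ofReal (f z) ∂μ = ENNReal.ofReal (ℓ f) := by
    intro f hf h0
    have h1 := hm 0 L.zero_mem f hf h0
    have hms : MeasurableSet (between 0 f) := by
      rw [hgen']; exact MeasurableSpace.measurableSet_generateFrom (between_mem hsup L.zero_mem hf)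
    rw [← hprod, Measure.prod_apply hms, sub_zero] at h1
    rw [← h1]
    simp [preimage_between]
  refine ⟨μ, hμfin, fun f hf => ?_⟩
  have hnonneg : ∀ f ∈ L, 0 ≤ f → Integrable f μ ∧ ∫ z, f z ∂μ = ℓ f := by
    intro f hf h0
    have hi : Integrable f μ :=
      ⟨(hmeas f hf).aestronglyMeasurable, by
        rw [hasFiniteIntegral_iff_ofReal (ae_of_all _ h0), hlint f hf h0]
        exact ENNReal.ofReal_lt_top⟩
    refine ⟨hi, ?_⟩
    rw [integral_eq_lintegral_of_nonneg_ae (ae_of_all _ h0) hi.1, hlint f hf h0,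
      ENNReal.toReal_ofReal (hpos f hf h0)]
  have hp := hnonneg (f ⊔ 0) (hsup _ hf _ L.zero_mem) le_sup_right
  have hn := hnonneg (-f ⊔ 0) (hsup _ (L.neg_mem hf) _ L.zero_mem) le_sup_right
  have hf_eq : f = (f ⊔ 0) - (-f ⊔ 0) := by
    ext z
    simp only [Pi.sub_apply, Pi.sup_apply, Pi.neg_apply, Pi.zero_apply]
    rcases le_total (f z) 0 with h | h <;> simp [h]
  rw [hf_eq]
  refine ⟨hp.1.sub hn.1, ?_⟩
  simp only [Pi.sub_apply]
  rw [integral_sub hp.1 hn.1, hp.2, hn.2, map_sub]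

end Daniell

/-! ### The maximal ergodic theorem. -/

section MaximalErgodic

open Set Filter Topology

variable {Ω : Type*} {τ : Ω → Ω} {f : Ω → ℝ}

/-- The maximum of the Birkhoff sums of lengths `0, …, n`. -/
noncomputable def birkhoffMax (τ : Ω → Ω) (f : Ω → ℝ) : ℕ → Ω → ℝ
  | 0, _ => 0
  | n + 1, ω => max 0 (f ω + birkhoffMax τ f n (τ ω))

lemma birkhoffMax_nonneg (n : ℕ) (ω : Ω) : 0 ≤ birkhoffMax τ f n ω := by
  cases n <;> simp [birkhoffMax]

lemma birkhoffMax_le_succ (n : ℕ) : ∀ ω, birkhoffMax τ f n ω ≤ birkhoffMax τ f (n + 1) ω := by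
  induction n with
  | zero => exact fun ω => birkhoffMax_nonneg _ _
  | succ n ih => exact fun ω => max_le_max le_rfl (add_le_add le_rfl (ih _))

lemma birkhoffSum_le_birkhoffMax (n : ℕ) : ∀ ω, birkhoffSum τ f n ω ≤ birkhoffMax τ f n ω := by
  induction n with
  | zero => simp [birkhoffMax]
  | succ n ih =>
    intro ω
    rw [birkhoffSum_succ']
    exact (add_le_add le_rfl (ih _)).trans (le_max_right _ _)

variable [MeasurableSpace Ω] {P : Measure Ω}

lemma integrable_birkhoffMax (hτ : MeasurePreserving τ P P) (hf : Integrable f P) (n : ℕ) :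
    Integrable (birkhoffMax τ f n) P := by
  induction n with
  | zero => exact integrable_zero _ _ _
  | succ n ih => exact (integrable_zero _ _ _).sup (hf.add (hτ.integrable_comp_of_integrable ih))

/-- **Maximal ergodic theorem**, for the maximum of finitely many Birkhoff sums. -/
lemma setIntegral_birkhoffMax_pos_nonneg (hτ : MeasurePreserving τ P P) (hfm : Measurable f)
    (hf : Integrable f P) (n : ℕ) : 0 ≤ ∫ ω in {ω | 0 < birkhoffMax τ f n ω}, f ω ∂P := by
  have hm : Measurable (birkhoffMax τ f n) := by
    induction n with
    | zero => exact measurable_const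
    | succ n ih => exact measurable_const.max (hfm.add (ih.comp hτ.measurable))
  have hs : MeasurableSet {ω | 0 < birkhoffMax τ f n ω} := measurableSet_lt measurable_const hm
  have hi := integrable_birkhoffMax hτ hf n
  have hic : Integrable (fun ω => birkhoffMax τ f n (τ ω)) P := hτ.integrable_comp_of_integrable hi
  have h0 : ∫ ω, (birkhoffMax τ f n ω - birkhoffMax τ f n (τ ω)) ∂P = 0 := by
    rw [integral_sub hi hic, sub_eq_zero]
    conv_lhs => rw [← hτ.map_eq]
    exact integral_map hτ.measurable.aemeasurable hm.aestronglyMeasurable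
  rw [← integral_indicator hs]
  -- Where the maximum `M_n` is positive it equals `f + M_{n-1} ∘ τ ≤ f + M_n ∘ τ`; elsewhere `M_n -
  -- M_n ∘ τ ≤ 0`. Integrating, the left side cancels by invariance.
  refine h0.symm.le.trans (integral_mono (hi.sub hic) (hf.indicator hs) fun ω => ?_)
  change _ ≤ indicator _ f ω
  by_cases hω : 0 < birkhoffMax τ f n ω
  · rw [indicator_of_mem (show ω ∈ {ω | 0 < birkhoffMax τ f n ω} from hω)]
    cases n with
    | zero => simp [birkhoffMax] at hω
    | succ n =>
      have h1 : birkhoffMax τ f (n + 1) ω = f ω + birkhoffMax τ f n (τ ω) := by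
        simp only [birkhoffMax] at hω ⊢
        exact max_eq_right ((lt_max_iff.1 hω).resolve_left (lt_irrefl _)).le
      have h2 := birkhoffMax_le_succ (τ := τ) (f := f) n (τ ω)
      linarith
  · rw [indicator_of_notMem (show ω ∉ {ω | 0 < birkhoffMax τ f n ω} from hω)]
    have := birkhoffMax_nonneg (τ := τ) (f := f) n (τ ω)
    linarith [not_lt.1 hω]

/-- A function with negative integral has nonpositive Birkhoff sums on a set of positive
measure. -/
lemma measure_birkhoffSum_nonpos_pos (hτ : MeasurePreserving τ P P) (hfm : Measurable f)
    (hf : Integrable f P) (hneg : ∫ ω, f ω ∂P < 0) :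
    0 < P {ω | ∀ n, birkhoffSum τ f n ω ≤ 0} := by
  rw [pos_iff_ne_zero]
  intro h0
  have hae : ∀ᵐ ω ∂P, ∃ n, 0 < birkhoffMax τ f n ω := by
    rw [ae_iff]
    refine measure_mono_null (t := {ω | ∀ n, birkhoffSum τ f n ω ≤ 0}) ?_ h0
    intro ω hω n
    simp only [mem_ofPred_eq, not_exists, not_lt] at hω
    exact (birkhoffSum_le_birkhoffMax n ω).trans (hω n)
  have hm : ∀ n, Measurable (birkhoffMax τ f n) := by
    intro n
    induction n with
    | zero => exact measurable_const
    | succ n ih => exact measurable_const.max (hfm.add (ih.comp hτ.measurable))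
  have hs : ∀ n, MeasurableSet {ω | 0 < birkhoffMax τ f n ω} := fun n =>
    measurableSet_lt measurable_const (hm n)
  -- If almost every orbit had a positive Birkhoff sum, the sets `{M_n > 0}` would exhaust the
  -- space, and the maximal inequality would give a nonnegative integral of `f`.
  have hlim : Tendsto (fun n => ∫ ω, indicator {ω | 0 < birkhoffMax τ f n ω} f ω ∂P) atTop
      (𝓝 (∫ ω, f ω ∂P)) := by
    refine tendsto_integral_of_dominated_convergence (fun ω => |f ω|)
      (fun n => (hf.indicator (hs n)).1) hf.abs (fun n => ae_of_all _ fun ω => ?_) ?_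
    · exact norm_indicator_le_norm_self _ _
    · filter_upwards [hae] with ω hω
      obtain ⟨n, hn⟩ := hω
      refine tendsto_const_nhds.congr' ?_
      filter_upwards [eventually_ge_atTop n] with k hk
      rw [indicator_of_mem]
      exact hn.trans_le
        (monotone_nat_of_le_succ (fun n => birkhoffMax_le_succ (τ := τ) (f := f) n ω) hk)
  have := ge_of_tendsto' hlim fun n => by
    rw [integral_indicator (hs n)]
    exact setIntegral_birkhoffMax_pos_nonneg hτ hfm hf n
  linarith

end MaximalErgodic

/-! ### Measurability of suprema over random compact sets. -/

section RandomCompact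

open Set Filter Topology

variable {Ω : Type*} [MeasurableSpace Ω] {M : Type*} [MetricSpace M]
  {K : Set (Ω × M)}

/-- A thickening is open, so a countable dense set suffices for a continuous function. Membership
becomes a condition on `infEDist`, which is measurable in `ω` for a random compact set. -/
lemma iSup_thickening_eq_iSup_denseSeq [SecondCountableTopology M] [Nonempty M] {F : M → EReal} (hF : Continuous F) (r : ℝ) (A : Set M) :
    ⨆ x ∈ Metric.thickening r A, F x =
      ⨆ i : ℕ, if Metric.infEDist (TopologicalSpace.denseSeq M i) A < ENNReal.ofReal r then
        F (TopologicalSpace.denseSeq M i) else ⊥ := by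
  apply le_antisymm
  · refine iSup₂_le fun x hx => le_of_forall_lt fun c hc => ?_
    obtain ⟨i, hi1, hi2⟩ := (TopologicalSpace.denseRange_denseSeq M).exists_mem_open
      ((isOpen_lt continuous_const hF).inter (Metric.isOpen_thickening (δ := r) (E := A)))
      ⟨x, hc, hx⟩
    exact lt_of_lt_of_le hi1 (le_iSup_of_le i (if_pos hi2).ge)
  · refine iSup_le fun i => ?_
    split_ifs with h
    · exact le_iSup₂_of_le (f := fun x (_ : x ∈ Metric.thickening r A) => F x) _ h le_rfl
    · exact bot_le

/-- For `c` above the supremum, the open set `{F < c}` contains the compact set and therefore one of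
its thickenings. -/
lemma iSup_eq_iInf_iSup_thickening {F : M → EReal} (hF : Continuous F) {A : Set M}
    (hA : IsCompact A) :
    ⨆ x ∈ A, F x = ⨅ n : ℕ, ⨆ x ∈ Metric.thickening (1 / ((n : ℝ) + 1)) A, F x := by
  apply le_antisymm
  · refine le_iInf fun n => iSup₂_le fun x hx => ?_
    exact le_iSup₂_of_le (f := fun x (_ : x ∈ Metric.thickening (1 / ((n : ℝ) + 1)) A) => F x) x
      (Metric.self_subset_thickening Nat.one_div_pos_of_nat A hx) le_rfl
  · refine le_of_forall_gt_imp_ge_of_dense fun c hc => ?_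
    obtain ⟨δ, hδ, h⟩ := hA.exists_thickening_subset_open (isOpen_lt hF continuous_const)
      (fun x hx => (le_iSup₂ (f := fun x (_ : x ∈ A) => F x) x hx).trans_lt hc)
    obtain ⟨n, hn⟩ := exists_nat_one_div_lt hδ
    refine iInf_le_of_le n (iSup₂_le fun x hx => ?_)
    exact (h (Metric.thickening_mono hn.le A hx)).le

variable [SecondCountableTopology M] [Nonempty M]

lemma measurable_iSup_thickening (hK : IsRandomCompact K) {F : Ω → M → EReal}
    (hFc : ∀ ω, Continuous (F ω)) (hFm : ∀ x, Measurable fun ω => F ω x) (r : ℝ) :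
    Measurable fun ω => ⨆ x ∈ Metric.thickening r (fibre K ω), F ω x := by
  simp_rw [iSup_thickening_eq_iSup_denseSeq (hFc _)]
  exact Measurable.iSup fun i =>
    Measurable.ite (measurableSet_lt (hK.measurable _) measurable_const) (hFm _) measurable_const

lemma measurable_iSup_fibre (hK : IsRandomCompact K) {F : Ω → M → EReal}
    (hFc : ∀ ω, Continuous (F ω)) (hFm : ∀ x, Measurable fun ω => F ω x) :
    Measurable fun ω => ⨆ x ∈ fibre K ω, F ω x := by
  simp_rw [iSup_eq_iInf_iSup_thickening (hFc _) (hK.isCompact _)]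
  exact Measurable.iInf fun n => measurable_iSup_thickening hK hFc hFm _

end RandomCompact

/-! ### Real-valued suprema on fibres. -/

section SupOn

open Set Filter Topology

variable {Ω M : Type*}

/-- The supremum of a real function on the fibre `A ω`. -/
noncomputable def supOn (A : Ω → Set M) (f : Ω × M → ℝ) (ω : Ω) : ℝ :=
  (⨆ x ∈ A ω, (f (ω, x) : EReal)).toReal

variable {A : Ω → Set M} {f g : Ω × M → ℝ} {ω : Ω} {c : ℝ}

/-- Nonemptiness and boundedness exclude the values `±∞`, which `toReal` would send to `0`. -/
lemma coe_supOn (hne : (A ω).Nonempty) (hc : ∀ x ∈ A ω, f (ω, x) ≤ c) :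
    (supOn A f ω : EReal) = ⨆ x ∈ A ω, (f (ω, x) : EReal) := by
  refine EReal.coe_toReal ?_ ?_
  · exact ((iSup₂_le fun x hx => EReal.coe_le_coe_iff.2 (hc x hx)).trans_lt
      (EReal.coe_lt_top c)).ne
  · obtain ⟨x, hx⟩ := hne
    exact ((EReal.bot_lt_coe _).trans_le
      (le_iSup₂ (f := fun x (_ : x ∈ A ω) => (f (ω, x) : EReal)) x hx)).ne'

lemma le_supOn (hc : ∀ x ∈ A ω, f (ω, x) ≤ c) {x : M} (hx : x ∈ A ω) :
    f (ω, x) ≤ supOn A f ω := by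
  rw [← EReal.coe_le_coe_iff, coe_supOn ⟨x, hx⟩ hc]
  exact le_iSup₂ (f := fun x (_ : x ∈ A ω) => (f (ω, x) : EReal)) x hx

lemma supOn_le (hne : (A ω).Nonempty) (hc : ∀ x ∈ A ω, f (ω, x) ≤ c) : supOn A f ω ≤ c := by
  rw [← EReal.coe_le_coe_iff, coe_supOn hne hc]
  exact iSup₂_le fun x hx => EReal.coe_le_coe_iff.2 (hc x hx)

lemma exists_supOn_eq [TopologicalSpace M] (hA : IsCompact (A ω)) (hne : (A ω).Nonempty)
    (hf : Continuous fun x => f (ω, x)) :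
    ∃ x ∈ A ω, supOn A f ω = f (ω, x) ∧ ∀ y ∈ A ω, f (ω, y) ≤ f (ω, x) := by
  obtain ⟨x, hx, hmax⟩ := hA.exists_isMaxOn hne hf.continuousOn
  exact ⟨x, hx, le_antisymm (supOn_le hne fun y hy => hmax hy) (le_supOn (fun y hy => hmax hy) hx),
    fun y hy => hmax hy⟩

end SupOn

/-! ### Test functions and the sublinear functional `meanSup`. -/

section TestFunctions

open Set Filter Topology

variable {Ω : Type*} [MeasurableSpace Ω] {M : Type*} [MetricSpace M] [MeasurableSpace M]

/-- The random continuous functions which are dominated on `K` by an integrable function on the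
base. -/
def testFunctions (P : Measure Ω) (K : Set (Ω × M)) : Submodule ℝ (Ω × M → ℝ) where
  carrier := {f | Measurable f ∧ (∀ ω, Continuous fun x => f (ω, x)) ∧
    ∃ h : Ω → ℝ, Integrable h P ∧ ∀ᵐ ω ∂P, ∀ x ∈ fibre K ω, |f (ω, x)| ≤ h ω}
  zero_mem' := ⟨measurable_const, fun _ => continuous_const, 0, integrable_zero _ _ _, by simp⟩
  add_mem' := by
    rintro f g ⟨hf, hfc, h, hh, hfh⟩ ⟨hg, hgc, k, hk, hgk⟩
    refine ⟨hf.add hg, fun ω => (hfc ω).add (hgc ω), h + k, hh.add hk, ?_⟩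
    filter_upwards [hfh, hgk] with ω h1 h2 x hx
    exact (abs_add_le _ _).trans (add_le_add (h1 x hx) (h2 x hx))
  smul_mem' := by
    rintro c f ⟨hf, hfc, h, hh, hfh⟩
    refine ⟨hf.const_smul c, fun ω => (hfc ω).const_smul c, |c| • h, hh.smul _, ?_⟩
    filter_upwards [hfh] with ω h1 x hx
    simp only [Pi.smul_apply, smul_eq_mul, abs_mul]
    gcongr
    exact h1 x hx

/-- The integral over the base of the supremum on the fibres of `K`. -/
noncomputable def meanSup (P : Measure Ω) (K : Set (Ω × M)) (f : Ω × M → ℝ) : ℝ :=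
  ∫ ω, supOn (fibre K) f ω ∂P

variable {P : Measure Ω} {K : Set (Ω × M)} {f g : Ω × M → ℝ}

lemma mem_testFunctions_of_abs_le (hfm : Measurable f) (hfc : ∀ ω, Continuous fun x => f (ω, x))
    (hg : g ∈ testFunctions P K) (hfg : ∀ᵐ ω ∂P, ∀ x ∈ fibre K ω, |f (ω, x)| ≤ |g (ω, x)|) :
    f ∈ testFunctions P K := by
  obtain ⟨-, -, h, hh, hgh⟩ := hg
  refine ⟨hfm, hfc, h, hh, ?_⟩
  filter_upwards [hfg, hgh] with ω h1 h2 x hx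
  exact (h1 x hx).trans (h2 x hx)

lemma mem_testFunctions_of_bounded [IsFiniteMeasure P] (hfm : Measurable f)
    (hfc : ∀ ω, Continuous fun x => f (ω, x)) {c : ℝ} (hc : ∀ z, |f z| ≤ c) :
    f ∈ testFunctions P K :=
  ⟨hfm, hfc, fun _ => c, integrable_const c, ae_of_all _ fun _ _ _ => hc _⟩

lemma one_mem_testFunctions [IsFiniteMeasure P] : (1 : Ω × M → ℝ) ∈ testFunctions P K :=
  mem_testFunctions_of_bounded measurable_const (fun _ => continuous_const) (c := 1) (by simp)

lemma sup_mem_testFunctions (hf : f ∈ testFunctions P K) (hg : g ∈ testFunctions P K) :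
    f ⊔ g ∈ testFunctions P K := by
  obtain ⟨hf, hfc, h, hh, hfh⟩ := hf
  obtain ⟨hg, hgc, k, hk, hgk⟩ := hg
  refine ⟨hf.sup hg, fun ω => (hfc ω).sup (hgc ω), h ⊔ k, hh.sup hk, ?_⟩
  filter_upwards [hfh, hgk] with ω h1 h2 _ hx
  exact abs_max_le_max_abs_abs.trans (max_le_max (h1 _ hx) (h2 _ hx))

lemma meanSup_smul (hK : IsRandomCompact K) (hne : ∀ᵐ ω ∂P, (fibre K ω).Nonempty)
    (hf : f ∈ testFunctions P K) {c : ℝ} (hc : 0 < c) :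
    meanSup P K (c • f) = c * meanSup P K f := by
  unfold meanSup
  rw [← integral_const_mul]
  refine integral_congr_ae ?_
  filter_upwards [hne] with ω h1
  obtain ⟨x, hx, he, hmax⟩ := exists_supOn_eq (hK.isCompact ω) h1
    ((Submodule.smul_mem _ c hf).2.1 ω)
  obtain ⟨y, hy, he1, hmax1⟩ := exists_supOn_eq (hK.isCompact ω) h1 (hf.2.1 ω)
  rw [he, he1]
  exact le_antisymm (mul_le_mul_of_nonneg_left (hmax1 x hx) hc.le) (hmax y hy)

variable [SecondCountableTopology M] [Nonempty M]

lemma measurable_supOn_fibre (hK : IsRandomCompact K) (hf : f ∈ testFunctions P K) :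
    Measurable (supOn (fibre K) f) :=
  (measurable_iSup_fibre hK (F := fun ω x => (f (ω, x) : EReal))
    (fun ω => continuous_coe_real_ereal.comp (hf.2.1 ω))
    (fun _ => (hf.1.comp (measurable_id.prodMk measurable_const)).coe_real_ereal)).ereal_toReal

lemma integrable_supOn_fibre (hK : IsRandomCompact K) (hne : ∀ᵐ ω ∂P, (fibre K ω).Nonempty)
    (hf : f ∈ testFunctions P K) : Integrable (supOn (fibre K) f) P := by
  obtain ⟨h, hh, hfh⟩ := hf.2.2
  refine hh.mono' (measurable_supOn_fibre hK hf).aestronglyMeasurable ?_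
  filter_upwards [hne, hfh] with ω h1 h2
  obtain ⟨x, hx, he, -⟩ := exists_supOn_eq (hK.isCompact ω) h1 (hf.2.1 ω)
  rw [he]
  exact h2 x hx

/-- Only values on `K` are compared, so functionals dominated by `meanSup` do not see what happens
off `K`. -/
lemma meanSup_mono (hK : IsRandomCompact K) (hne : ∀ᵐ ω ∂P, (fibre K ω).Nonempty)
    (hf : f ∈ testFunctions P K) (hg : g ∈ testFunctions P K)
    (hfg : ∀ᵐ ω ∂P, ∀ x ∈ fibre K ω, f (ω, x) ≤ g (ω, x)) : meanSup P K f ≤ meanSup P K g := by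
  refine integral_mono_ae (integrable_supOn_fibre hK hne hf) (integrable_supOn_fibre hK hne hg) ?_
  filter_upwards [hne, hfg] with ω h1 h2
  obtain ⟨x, hx, he, -⟩ := exists_supOn_eq (hK.isCompact ω) h1 (hf.2.1 ω)
  obtain ⟨y, hy, he', hmax⟩ := exists_supOn_eq (hK.isCompact ω) h1 (hg.2.1 ω)
  rw [he, he']
  exact (h2 x hx).trans (hmax x hx)

lemma meanSup_add_le (hK : IsRandomCompact K) (hne : ∀ᵐ ω ∂P, (fibre K ω).Nonempty)
    (hf : f ∈ testFunctions P K) (hg : g ∈ testFunctions P K) :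
    meanSup P K (f + g) ≤ meanSup P K f + meanSup P K g := by
  have hif := integrable_supOn_fibre hK hne hf
  have hig := integrable_supOn_fibre hK hne hg
  have hfg := Submodule.add_mem _ hf hg
  unfold meanSup
  rw [← integral_add hif hig]
  refine integral_mono_ae (integrable_supOn_fibre hK hne hfg) (hif.add hig) ?_
  filter_upwards [hne] with ω h1
  obtain ⟨x, hx, he, -⟩ := exists_supOn_eq (hK.isCompact ω) h1 (hfg.2.1 ω)
  obtain ⟨y, hy, he1, hmax1⟩ := exists_supOn_eq (hK.isCompact ω) h1 (hf.2.1 ω)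
  obtain ⟨z, hz, he2, hmax2⟩ := exists_supOn_eq (hK.isCompact ω) h1 (hg.2.1 ω)
  rw [he, he1, he2]
  exact add_le_add (hmax1 x hx) (hmax2 x hx)

/-- By Dini's theorem, `meanSup` is continuous along sequences decreasing to zero. -/
lemma tendsto_meanSup_zero (hK : IsRandomCompact K) (hne : ∀ᵐ ω ∂P, (fibre K ω).Nonempty)
    {F : ℕ → Ω × M → ℝ} (hF : ∀ n, F n ∈ testFunctions P K) (hanti : Antitone F)
    (hlim : ∀ z, Tendsto (fun n => F n z) atTop (𝓝 0)) :
    Tendsto (fun n => meanSup P K (F n)) atTop (𝓝 0) := by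
  have h0 : ∫ _, (0 : ℝ) ∂P = 0 := integral_zero _ _
  rw [← h0]
  have hnonneg : ∀ n z, 0 ≤ F n z := fun n z =>
    (antitone_iff_forall_lt.2 fun i j hij => hanti hij.le z : Antitone fun n => F n z).le_of_tendsto
      (hlim z) n
  refine tendsto_integral_of_dominated_convergence (supOn (fibre K) (F 0))
    (fun n => (measurable_supOn_fibre hK (hF n)).aestronglyMeasurable)
    (integrable_supOn_fibre hK hne (hF 0)) (fun n => ?_) ?_
  · filter_upwards [hne] with ω h1
    obtain ⟨x, hx, he, -⟩ := exists_supOn_eq (hK.isCompact ω) h1 ((hF n).2.1 ω)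
    obtain ⟨y, hy, he1, hmax1⟩ := exists_supOn_eq (hK.isCompact ω) h1 ((hF 0).2.1 ω)
    rw [he, he1, Real.norm_of_nonneg (hnonneg _ _)]
    exact (hanti (Nat.zero_le n) _).trans (hmax1 x hx)
  · filter_upwards [hne] with ω h1
    have hu := Antitone.tendstoUniformlyOn_of_forall_tendsto (F := fun n x => F n (ω, x))
      (f := fun _ => 0) (hK.isCompact ω) (fun n => ((hF n).2.1 ω).continuousOn)
      (fun x _ i j hij => hanti hij _) continuousOn_const (fun x _ => hlim _)
    rw [Metric.tendstoUniformlyOn_iff] at hu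
    rw [Metric.tendsto_nhds]
    intro ε hε
    filter_upwards [hu ε hε] with n hn
    obtain ⟨x, hx, he, -⟩ := exists_supOn_eq (hK.isCompact ω) h1 ((hF n).2.1 ω)
    rw [he, dist_comm]
    exact hn x hx

end TestFunctions

/-! ### Test functions generate the product σ-algebra. -/

section MeasurableStructure

open Set Filter Topology

variable {Ω : Type*} [MeasurableSpace Ω] {M : Type*} [MetricSpace M] [MeasurableSpace M]
  [BorelSpace M] {P : Measure Ω} {K : Set (Ω × M)}

lemma indicator_mul_mem_testFunctions [IsFiniteMeasure P] {A : Set Ω} (hA : MeasurableSet A)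
    {g : M → ℝ} (hg : Continuous g) {c : ℝ} (hc : ∀ x, |g x| ≤ c) :
    (fun z : Ω × M => A.indicator (fun _ => (1 : ℝ)) z.1 * g z.2) ∈ testFunctions P K := by
  refine mem_testFunctions_of_bounded (c := c) ?_ (fun ω => by dsimp only; fun_prop) fun z => ?_
  · exact ((measurable_const.indicator hA).comp measurable_fst).mul
      (hg.measurable.comp measurable_snd)
  · have : 0 ≤ c := (abs_nonneg _).trans (hc z.2)
    by_cases h : z.1 ∈ A <;> simp [h, this, hc]

lemma prod_le_generateFrom_testFunctions [IsFiniteMeasure P] :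
    Prod.instMeasurableSpace (α := Ω) (β := M) ≤
      MeasurableSpace.generateFrom {s | ∃ f ∈ testFunctions P K, s = {z | 0 < f z}} := by
  refine sup_le ?_ ?_
  · rintro _ ⟨A, hA, rfl⟩
    refine MeasurableSpace.measurableSet_generateFrom ⟨_, indicator_mul_mem_testFunctions hA
      (g := fun _ => 1) continuous_const (c := 1) (by simp), ?_⟩
    ext z
    by_cases h : z.1 ∈ A <;> simp [h]
  · refine MeasurableSpace.comap_le_iff_le_map.2 ((BorelSpace.measurable_eq (α := M)).le.trans
      (MeasurableSpace.generateFrom_le fun U hU => ?_))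
    have hU : IsOpen U := hU
    -- The minimum with `1` matters for `U = univ`: the distance to the empty complement is `∞`,
    -- which `toReal` would turn into `0`.
    refine MeasurableSpace.measurableSet_generateFrom ⟨_, indicator_mul_mem_testFunctions .univ
      (g := fun x => (min 1 (Metric.infEDist x Uᶜ)).toReal) ?_ (c := 1) ?_, ?_⟩
    · refine continuous_iff_continuousAt.2 fun x => ?_
      exact (ENNReal.continuousAt_toReal (by simp)).comp
        (continuous_const.min Metric.continuous_infEDist).continuousAt
    · intro x
      rw [abs_of_nonneg ENNReal.toReal_nonneg]
      exact ENNReal.toReal_le_of_le_ofReal zero_le_one (by simp)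
    · ext z
      have hU' : z.2 ∈ U ↔ 0 < Metric.infEDist z.2 Uᶜ := by
        rw [pos_iff_ne_zero, Ne, ← Metric.mem_iff_infEDist_zero_of_closed hU.isClosed_compl,
          mem_compl_iff, not_not]
      simp [hU', ENNReal.toReal_pos_iff]

end MeasurableStructure

/-! ### Cardinality of the fibres. -/

section Cardinality

open Set Filter Topology TopologicalSpace

variable {Ω M : Type*} [MetricSpace M] {K : Set (Ω × M)}

/-- The event that the fibre of `K` contains `N` points at mutual distances larger than `δ`. -/
def separatedSet (K : Set (Ω × M)) (N : ℕ) (δ : ℝ) : Set Ω :=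
  {ω | ∃ x : Fin N → M, (∀ i, x i ∈ fibre K ω) ∧ ∀ i j, i ≠ j → δ < dist (x i) (x j)}

lemma separatedSet_anti (N : ℕ) : Antitone (separatedSet K N) := by
  rintro a b hab ω ⟨x, hx, h⟩
  exact ⟨x, hx, fun i j hij => hab.trans_lt (h i j hij)⟩

lemma le_encard_iff_exists_injective {α : Type*} {s : Set α} {N : ℕ} :
    (N : ℕ∞) ≤ s.encard ↔ ∃ x : Fin N → α, (∀ i, x i ∈ s) ∧ Function.Injective x := by
  constructor
  · intro h
    obtain ⟨t, hts, ht⟩ := exists_subset_encard_eq h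
    have hfin : t.Finite := finite_of_encard_eq_coe ht
    have hcard : hfin.toFinset.card = N := by
      rw [hfin.encard_eq_coe_toFinset_card] at ht
      exact_mod_cast ht
    let e := (hfin.toFinset.equivFinOfCardEq hcard).symm
    refine ⟨fun i => (e i : α), fun i => hts ?_, fun i j hij => e.injective (Subtype.ext hij)⟩
    exact hfin.mem_toFinset.1 (e i).2
  · rintro ⟨x, hx, hinj⟩
    have h1 : (range x).encard = N := by
      rw [← image_univ, hinj.encard_image]; simp
    rw [← h1]
    exact encard_le_encard (range_subset_iff.2 hx)

lemma setOf_le_encard_eq_iUnion_separatedSet (N : ℕ) :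
    {ω | (N : ℕ∞) ≤ (fibre K ω).encard} = ⋃ n : ℕ, separatedSet K N (1 / ((n : ℝ) + 1)) := by
  ext ω
  simp only [mem_ofPred_eq, mem_iUnion, le_encard_iff_exists_injective, separatedSet]
  constructor
  · rintro ⟨x, hx, hinj⟩
    have h : ∀ᶠ n : ℕ in atTop, ∀ i j, i ≠ j → 1 / ((n : ℝ) + 1) < dist (x i) (x j) := by
      simp only [eventually_all]
      intro i j hij
      exact tendsto_one_div_add_atTop_nhds_zero_nat.eventually_lt_const
        (dist_pos.2 (hinj.ne hij))
    obtain ⟨n, hn⟩ := h.exists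
    exact ⟨n, x, hx, hn⟩
  · rintro ⟨n, x, hx, hn⟩
    refine ⟨x, hx, fun i j hij => ?_⟩
    by_contra hne
    have := hn i j hne
    rw [hij, dist_self] at this
    exact absurd this (not_lt.2 (by positivity))

variable [MeasurableSpace Ω] [SecondCountableTopology M] [Nonempty M] {P : Measure Ω}

/-- Separated points of the fibre are replaced by nearby points of a countable dense sequence;
strictness of the separation leaves room for the error. -/
lemma measurableSet_separatedSet (hK : IsRandomCompact K) (N : ℕ) (δ : ℝ) :
    MeasurableSet (separatedSet K N δ) := by
  have : separatedSet K N δ = ⋃ (k : Fin N → ℕ) (n : ℕ)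
      (_ : ∀ i j, i ≠ j → δ + 2 * (1 / ((n : ℝ) + 1)) < dist (denseSeq M (k i)) (denseSeq M (k j))),
      ⋂ i, {ω | Metric.infEDist (denseSeq M (k i)) (fibre K ω) <
        ENNReal.ofReal (1 / ((n : ℝ) + 1))} := by
    ext ω
    simp only [separatedSet, mem_iUnion, mem_iInter, mem_ofPred_eq, exists_prop]
    constructor
    · rintro ⟨x, hx, h⟩
      -- Of the four units of slack, two are lost in moving both points to the dense sequence and
      -- two are the margin required there.
      have hev : ∀ᶠ n : ℕ in atTop, ∀ i j, i ≠ j →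
          4 * (1 / ((n : ℝ) + 1)) < dist (x i) (x j) - δ := by
        simp only [eventually_all]
        intro i j hij
        refine (tendsto_one_div_add_atTop_nhds_zero_nat.const_mul 4).eventually_lt_const ?_
        linarith [h i j hij]
      obtain ⟨n, hn⟩ := hev.exists
      have hpos : (0 : ℝ) < 1 / ((n : ℝ) + 1) := Nat.one_div_pos_of_nat
      choose k hk using fun i => (denseRange_denseSeq M).exists_dist_lt (x i) hpos
      refine ⟨k, n, fun i j hij => ?_, fun i => ?_⟩
      · have h1 := hn i j hij
        have h2 := dist_triangle4 (x i) (denseSeq M (k i)) (denseSeq M (k j)) (x j)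
        have h3 := hk j
        rw [dist_comm] at h3
        linarith [hk i]
      · refine Metric.infEDist_lt_iff.2 ⟨x i, hx i, ?_⟩
        rw [edist_comm, edist_dist]
        exact (ENNReal.ofReal_lt_ofReal_iff hpos).2 (hk i)
    · rintro ⟨k, n, hd, hk⟩
      choose x hx hxk using fun i => Metric.infEDist_lt_iff.1 (hk i)
      have hpos : (0 : ℝ) < 1 / ((n : ℝ) + 1) := Nat.one_div_pos_of_nat
      have hxd : ∀ i, dist (denseSeq M (k i)) (x i) < 1 / ((n : ℝ) + 1) := fun i => by
        have := hxk i
        rwa [edist_dist, ENNReal.ofReal_lt_ofReal_iff hpos] at this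
      refine ⟨x, hx, fun i j hij => ?_⟩
      have h2 := dist_triangle4 (denseSeq M (k i)) (x i) (x j) (denseSeq M (k j))
      have h3 := hxd j
      rw [dist_comm] at h3
      linarith [hd i j hij, hxd i]
  rw [this]
  exact .iUnion fun k => .iUnion fun n => .iUnion fun _ => .iInter fun i =>
    measurableSet_lt (hK.measurable _) measurable_const

lemma measurableSet_le_encard (hK : IsRandomCompact K) (N : ℕ) :
    MeasurableSet {ω | (N : ℕ∞) ≤ (fibre K ω).encard} := by
  rw [setOf_le_encard_eq_iUnion_separatedSet]
  exact .iUnion fun n => measurableSet_separatedSet hK N _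

/-- Over an ergodic base, the cardinality of the fibres of an invariant random compact set is
almost surely constant as soon as it is not almost surely infinite. -/
lemma exists_ae_encard_eq [IsProbabilityMeasure P] {θ : Ω → Ω} (hθ : Ergodic θ P)
    {T : Ω → M → M} (hK : IsRandomCompact K) (hinv : IsInvariant P θ T K) {N : ℕ}
    (hN : ¬ ∀ᵐ ω ∂P, (N : ℕ∞) ≤ (fibre K ω).encard) :
    ∃ n : ℕ, ∀ᵐ ω ∂P, (fibre K ω).encard = n := by
  classical
  have hex : ∃ N : ℕ, ¬ ∀ᵐ ω ∂P, (N : ℕ∞) ≤ (fibre K ω).encard := ⟨N, hN⟩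
  obtain ⟨n, hn⟩ : ∃ n, Nat.find hex = n + 1 := by
    refine Nat.exists_eq_succ_of_ne_zero fun h0 => ?_
    exact (Nat.find_eq_zero hex).1 h0 (by simp)
  have h1 : ∀ᵐ ω ∂P, (n : ℕ∞) ≤ (fibre K ω).encard :=
    not_not.1 (Nat.find_min hex (m := n) (by omega))
  have h2 : ¬ ∀ᵐ ω ∂P, ((n + 1 : ℕ) : ℕ∞) ≤ (fibre K ω).encard := hn ▸ Nat.find_spec hex
  -- The fibre over `θ ω` is an image of the fibre over `ω`, so it cannot have more points. Here `n
  -- + 1` is the least cardinality not reached almost surely.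
  have hpre : θ ⁻¹' {ω | ((n + 1 : ℕ) : ℕ∞) ≤ (fibre K ω).encard} ≤ᵐ[P]
      {ω | ((n + 1 : ℕ) : ℕ∞) ≤ (fibre K ω).encard} := by
    filter_upwards [hinv] with ω hω h
    change ((n + 1 : ℕ) : ℕ∞) ≤ (fibre K (θ ω)).encard at h
    rw [← hω] at h
    exact h.trans (encard_image_le _ _)
  rcases hθ.ae_empty_or_univ_of_preimage_ae_le
    (measurableSet_le_encard hK _).nullMeasurableSet hpre with h | h
  · refine ⟨n, ?_⟩
    filter_upwards [h1, ae_eq_empty.1 h |> measure_eq_zero_iff_ae_notMem.1] with ω h3 h4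
    refine le_antisymm ?_ h3
    have h5 : (fibre K ω).encard < ((n + 1 : ℕ) : ℕ∞) := not_le.1 h4
    exact ENat.lt_natCast_add_one_iff.1 (by exact_mod_cast h5)
  · exact absurd (eventuallyEq_univ.1 h) h2

/-- If, on an event of positive probability, the fibres of a random compact set are mapped onto
fibres by maps that contract all pairs of close points uniformly to zero,
then the fibres are not almost surely infinite. -/
lemma exists_not_ae_le_encard [IsFiniteMeasure P] (hK : IsRandomCompact K) {σ : ℕ → Ω → Ω}
    (hσ : ∀ n, MeasurePreserving (σ n) P P) {A : Set Ω} (hA : P A ≠ 0) {ρ : ℝ} (hρ : 0 < ρ)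
    {c : ℕ → ℝ} (hc : Tendsto c atTop (𝓝 0)) {F : ℕ → Ω → M → M}
    (hF : ∀ ω ∈ A, ∀ n, fibre K (σ n ω) = F n ω '' fibre K ω)
    (hcontr : ∀ ω ∈ A, ∀ n, ∀ x ∈ fibre K ω, ∀ y ∈ fibre K ω, dist x y < ρ →
      dist (F n ω x) (F n ω y) ≤ c n) :
    ∃ N : ℕ, ¬ ∀ᵐ ω ∂P, (N : ℕ∞) ≤ (fibre K ω).encard := by
  -- Covering a compact fibre by finitely many balls of radius `ρ / 2`, the pigeonhole principle
  -- puts `ω ∈ A` in some `B N`.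
  let B : ℕ → Set Ω := fun N => {ω ∈ A | ∀ x : Fin N → M, (∀ i, x i ∈ fibre K ω) →
    ∃ i j, i ≠ j ∧ dist (x i) (x j) < ρ}
  have hAB : A ⊆ ⋃ N, B N := by
    intro ω hω
    obtain ⟨t, -, htf, hcov⟩ := (hK.isCompact ω).finite_cover_balls (half_pos hρ)
    have := htf.fintype
    refine mem_iUnion.2 ⟨Fintype.card t + 1, hω, fun x hx => ?_⟩
    have hex : ∀ i, ∃ y : t, dist (x i) y < ρ / 2 := fun i => by
      obtain ⟨y, hy, hxy⟩ := mem_iUnion₂.1 (hcov (hx i))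
      exact ⟨⟨y, hy⟩, hxy⟩
    choose y hy using hex
    obtain ⟨i, j, hij, he⟩ := Fintype.exists_ne_map_eq_of_card_lt y (by simp)
    refine ⟨i, j, hij, (dist_triangle_right _ _ (y i : M)).trans_lt ?_⟩
    have h2 := hy j
    rw [← he] at h2
    linarith [hy i]
  obtain ⟨N, hN⟩ : ∃ N, P (B N) ≠ 0 := by
    by_contra! h
    exact hA (measure_mono_null hAB (measure_iUnion_null h))
  refine ⟨N, fun hae => ?_⟩
  -- The lower bound `P (B N)` is independent of `δ`. Only the separated sets need be measurable, so
  -- `A` and `B N` may enter through outer measure.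
  have hbound : ∀ δ : ℝ, 0 < δ → P (B N) ≤ P (separatedSet K N δ)ᶜ := by
    intro δ hδ
    obtain ⟨n, hn⟩ := (hc.eventually_lt_const hδ).exists
    rw [← (hσ n).measure_preimage (measurableSet_separatedSet hK N δ).compl.nullMeasurableSet]
    refine measure_mono ?_
    rintro ω ⟨hω, hB⟩ ⟨y, hy, hsep⟩
    rw [hF ω hω n] at hy
    choose x hx hxy using hy
    obtain ⟨i, j, hij, hd⟩ := hB x hx
    have h1 := hcontr ω hω n _ (hx i) _ (hx j) hd
    rw [hxy, hxy] at h1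
    linarith [hsep i j hij]
  have hlim := tendsto_measure_iInter_atTop (μ := P)
    (s := fun n : ℕ => (separatedSet K N (1 / ((n : ℝ) + 1)))ᶜ)
    (fun n => (measurableSet_separatedSet hK N _).compl.nullMeasurableSet)
    (fun m n hmn => compl_subset_compl.2 (separatedSet_anti N (Nat.one_div_le_one_div hmn)))
    ⟨0, measure_ne_top _ _⟩
  rw [← compl_iUnion, ← setOf_le_encard_eq_iUnion_separatedSet] at hlim
  have h0 : P {ω | (N : ℕ∞) ≤ (fibre K ω).encard}ᶜ = 0 := hae
  rw [h0] at hlim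
  exact hN (le_zero_iff.1 (ge_of_tendsto' hlim fun n => hbound _ Nat.one_div_pos_of_nat))

end Cardinality

/-! ### The skew product acting on test functions. -/

section Skew

open Set Filter Topology

variable {Ω M : Type*} {θ : Ω → Ω} {T : Ω → M → M}

lemma iter_add (m n : ℕ) (ω : Ω) (x : M) :
    iter θ T (m + n) ω x = iter θ T n (θ^[m] ω) (iter θ T m ω x) := by
  induction n with
  | zero => rfl
  | succ n ih =>
    rw [← add_assoc, iter, ih, iter, ← Function.iterate_add_apply, add_comm n m]

lemma iterate_skew (n : ℕ) (ω : Ω) (x : M) :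
    (skew θ T)^[n] (ω, x) = (θ^[n] ω, iter θ T n ω x) := by
  induction n with
  | zero => rfl
  | succ n ih =>
    rw [Function.iterate_succ_apply', ih, Function.iterate_succ_apply']
    rfl

variable [MeasurableSpace Ω] {P : Measure Ω} {K : Set (Ω × M)}

/-- Almost surely the whole forward orbit of `K(ω)` follows the fibres of `K`. -/
lemma IsInvariant.ae_iter_image (hinv : IsInvariant P θ T K) (hθ : MeasurePreserving θ P P) :
    ∀ᵐ ω ∂P, ∀ n, iter θ T n ω '' fibre K ω = fibre K (θ^[n] ω) := by
  have h : ∀ᵐ ω ∂P, ∀ n, T (θ^[n] ω) '' fibre K (θ^[n] ω) = fibre K (θ (θ^[n] ω)) :=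
    ae_all_iff.2 fun n => (hθ.iterate n).quasiMeasurePreserving.ae hinv
  filter_upwards [h] with ω hω n
  induction n with
  | zero => simp [iter]
  | succ n ih =>
    rw [Function.iterate_succ_apply', ← hω n, ← ih, image_image]
    rfl

variable [MetricSpace M] [MeasurableSpace M] {f : Ω × M → ℝ}

lemma comp_skew_mem_testFunctions (hθ : MeasurePreserving θ P P) (hinv : IsInvariant P θ T K)
    (hTm : Measurable (skew θ T)) (hTc : ∀ ω, Continuous (T ω)) (hf : f ∈ testFunctions P K) :
    f ∘ skew θ T ∈ testFunctions P K := by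
  obtain ⟨h, hh, hfh⟩ := hf.2.2
  refine ⟨hf.1.comp hTm, fun ω => (hf.2.1 (θ ω)).comp (hTc ω), h ∘ θ,
    hθ.integrable_comp_of_integrable hh, ?_⟩
  filter_upwards [hinv, hθ.quasiMeasurePreserving.ae hfh] with ω h1 h2 x hx
  exact h2 _ (h1 ▸ mem_image_of_mem _ hx)

lemma iterate_comp_mem_testFunctions (hθ : MeasurePreserving θ P P) (hinv : IsInvariant P θ T K)
    (hTm : Measurable (skew θ T)) (hTc : ∀ ω, Continuous (T ω)) (hf : f ∈ testFunctions P K)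
    (n : ℕ) : f ∘ (skew θ T)^[n] ∈ testFunctions P K := by
  induction n with
  | zero => exact hf
  | succ n ih => exact comp_skew_mem_testFunctions hθ hinv hTm hTc ih

variable [SecondCountableTopology M] [Nonempty M]

/-- The supremum of `f ∘ skew θ T` over `K(ω)` is that of `f` over `T_ω(K(ω)) = K(θ ω)`, and `θ`
preserves `P`. -/
lemma meanSup_comp_skew (hK : IsRandomCompact K) (hθ : MeasurePreserving θ P P)
    (hinv : IsInvariant P θ T K) (hf : f ∈ testFunctions P K) :
    meanSup P K (f ∘ skew θ T) = meanSup P K f := by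
  have h1 : supOn (fibre K) (f ∘ skew θ T) =ᵐ[P] supOn (fibre K) f ∘ θ := by
    filter_upwards [hinv] with ω hω
    simp only [supOn, Function.comp_apply]
    rw [← hω, iSup_image]
    rfl
  unfold meanSup
  rw [integral_congr_ae h1]
  conv_rhs => rw [← hθ.map_eq]
  exact (integral_map hθ.measurable.aemeasurable
    (measurable_supOn_fibre hK hf).aestronglyMeasurable).symm

lemma meanSup_comp_iterate_skew (hK : IsRandomCompact K) (hθ : MeasurePreserving θ P P)
    (hinv : IsInvariant P θ T K) (hTm : Measurable (skew θ T)) (hTc : ∀ ω, Continuous (T ω))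
    (hf : f ∈ testFunctions P K) (n : ℕ) :
    meanSup P K (f ∘ (skew θ T)^[n]) = meanSup P K f := by
  induction n with
  | zero => rfl
  | succ n ih =>
    rw [← ih, Function.iterate_succ, ← Function.comp_assoc]
    exact meanSup_comp_skew hK hθ hinv (iterate_comp_mem_testFunctions hθ hinv hTm hTc hf n)

end Skew

/-! ### Truncated logarithms of derivative norms. -/

section Derivative

open Set Filter Topology

/-- Directional derivatives are limits of measurable difference quotients, and a bound on the
operator norm can be tested on a countable dense set of vectors. -/
lemma measurable_norm_fderiv {Ω E F : Type*} [MeasurableSpace Ω] [NormedAddCommGroup E]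
    [NormedSpace ℝ E] [SecondCountableTopology E] [NormedAddCommGroup F] [NormedSpace ℝ F]
    [MeasurableSpace F] [BorelSpace F] [SecondCountableTopology F] {g : Ω → E → F} {x : E}
    (hd : ∀ ω, DifferentiableAt ℝ (g ω) x) (hm : ∀ y, Measurable fun ω => g ω y) :
    Measurable fun ω => ‖fderiv ℝ (g ω) x‖ := by
  have hv : ∀ v, Measurable fun ω => fderiv ℝ (g ω) x v := by
    intro v
    refine measurable_of_tendsto_metrizable
      (f := fun (n : ℕ) ω => (n : ℝ) • (g ω (x + (n : ℝ)⁻¹ • v) - g ω x))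
      (fun n => ((hm _).sub (hm _)).const_smul _) (tendsto_pi_nhds.2 fun ω => ?_)
    exact (hd ω).hasFDerivAt.lim v (tendsto_norm_atTop_atTop.comp tendsto_natCast_atTop_atTop)
  refine measurable_of_Iic fun c => ?_
  rcases lt_or_ge c 0 with hc | hc
  · convert MeasurableSet.empty
    refine eq_empty_of_forall_notMem fun ω hω => ?_
    exact absurd ((norm_nonneg _).trans hω) (not_le.2 hc)
  · have : (fun ω => ‖fderiv ℝ (g ω) x‖) ⁻¹' Iic c = ⋂ i : ℕ,
        {ω | ‖fderiv ℝ (g ω) x (TopologicalSpace.denseSeq E i)‖ ≤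
          c * ‖TopologicalSpace.denseSeq E i‖} := by
      ext ω
      simp only [mem_preimage, mem_Iic, mem_iInter, mem_ofPred_eq]
      rw [ContinuousLinearMap.opNorm_le_iff hc]
      refine ⟨fun h i => h _, fun h v => ?_⟩
      exact (TopologicalSpace.denseRange_denseSeq E).induction_on
        (p := fun v => ‖fderiv ℝ (g ω) x v‖ ≤ c * ‖v‖) v
        (isClosed_le (fderiv ℝ (g ω) x).continuous.norm (continuous_const.mul continuous_norm)) h
    rw [this]
    exact .iInter fun i => measurableSet_le (hv _).norm measurable_const

variable {Ω : Type*} {d : ℕ} {θ : Ω → Ω}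
  {T : Ω → EuclideanSpace ℝ (Fin d) → EuclideanSpace ℝ (Fin d)}

/-- The logarithm of the norm of the derivative of `T_ω^k`, cut off below at `-k m`. -/
noncomputable def truncLogDeriv (θ : Ω → Ω)
    (T : Ω → EuclideanSpace ℝ (Fin d) → EuclideanSpace ℝ (Fin d)) (m k : ℕ)
    (z : Ω × EuclideanSpace ℝ (Fin d)) : ℝ :=
  Real.log (max ‖fderiv ℝ (iter θ T k z.1) z.2‖ (Real.exp (-(k * m))))

lemma contDiff_iter (hT : ∀ ω, ContDiff ℝ 1 (T ω)) (n : ℕ) (ω : Ω) :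
    ContDiff ℝ 1 (iter θ T n ω) := by
  induction n with
  | zero => exact contDiff_id
  | succ n ih => exact (hT _).comp ih

lemma norm_fderiv_iter_add_le (hT : ∀ ω, ContDiff ℝ 1 (T ω)) (i j : ℕ) (ω : Ω)
    (x : EuclideanSpace ℝ (Fin d)) :
    ‖fderiv ℝ (iter θ T (i + j) ω) x‖ ≤
      ‖fderiv ℝ (iter θ T j (θ^[i] ω)) (iter θ T i ω x)‖ * ‖fderiv ℝ (iter θ T i ω) x‖ := by
  have h : iter θ T (i + j) ω = iter θ T j (θ^[i] ω) ∘ iter θ T i ω :=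
    funext fun x => iter_add i j ω x
  rw [h, fderiv_comp _ ((contDiff_iter hT j _).differentiable one_ne_zero _)
    ((contDiff_iter hT i _).differentiable one_ne_zero _)]
  exact ContinuousLinearMap.opNorm_comp_le _ _

lemma exp_truncLogDeriv (m k : ℕ) (z : Ω × EuclideanSpace ℝ (Fin d)) :
    Real.exp (truncLogDeriv θ T m k z) =
      max ‖fderiv ℝ (iter θ T k z.1) z.2‖ (Real.exp (-(k * m))) :=
  Real.exp_log (lt_max_of_lt_right (Real.exp_pos _))

lemma truncLogDeriv_le_iff {m k : ℕ} {z : Ω × EuclideanSpace ℝ (Fin d)} {c : ℝ} :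
    truncLogDeriv θ T m k z ≤ c ↔
      ‖fderiv ℝ (iter θ T k z.1) z.2‖ ≤ Real.exp c ∧ -((k : ℝ) * m) ≤ c := by
  rw [← Real.exp_le_exp, exp_truncLogDeriv, max_le_iff, Real.exp_le_exp]

lemma neg_mul_le_truncLogDeriv (m k : ℕ) (z : Ω × EuclideanSpace ℝ (Fin d)) :
    -((k : ℝ) * m) ≤ truncLogDeriv θ T m k z :=
  (truncLogDeriv_le_iff.1 le_rfl).2

lemma norm_fderiv_le_exp_truncLogDeriv (m k : ℕ) (z : Ω × EuclideanSpace ℝ (Fin d)) :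
    ‖fderiv ℝ (iter θ T k z.1) z.2‖ ≤ Real.exp (truncLogDeriv θ T m k z) :=
  (truncLogDeriv_le_iff.1 le_rfl).1

lemma truncLogDeriv_anti {m m' : ℕ} (h : m ≤ m') (k : ℕ) (z : Ω × EuclideanSpace ℝ (Fin d)) :
    truncLogDeriv θ T m' k z ≤ truncLogDeriv θ T m k z := by
  refine truncLogDeriv_le_iff.2 ⟨norm_fderiv_le_exp_truncLogDeriv m k z, ?_⟩
  refine le_trans ?_ (neg_mul_le_truncLogDeriv m k z)
  gcongr

/-- The chain rule gives subadditivity before truncation; it survives because the cut-off `-k m` is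
additive in `k`. -/
lemma truncLogDeriv_add_le (hT : ∀ ω, ContDiff ℝ 1 (T ω)) (m i j : ℕ)
    (z : Ω × EuclideanSpace ℝ (Fin d)) :
    truncLogDeriv θ T m (i + j) z ≤
      truncLogDeriv θ T m i z + truncLogDeriv θ T m j ((skew θ T)^[i] z) := by
  obtain ⟨ω, x⟩ := z
  rw [iterate_skew]
  refine truncLogDeriv_le_iff.2 ⟨?_, ?_⟩
  · rw [Real.exp_add, mul_comm]
    refine (norm_fderiv_iter_add_le hT i j ω x).trans ?_
    gcongr
    · exact norm_fderiv_le_exp_truncLogDeriv m j (θ^[i] ω, iter θ T i ω x)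
    · exact norm_fderiv_le_exp_truncLogDeriv m i (ω, x)
  · have h1 := neg_mul_le_truncLogDeriv (θ := θ) (T := T) m i (ω, x)
    have h2 := neg_mul_le_truncLogDeriv (θ := θ) (T := T) m j (θ^[i] ω, iter θ T i ω x)
    push_cast
    linarith

lemma logNormDeriv_le_coe_iff {k : ℕ} {z : Ω × EuclideanSpace ℝ (Fin d)} {c : ℝ} :
    logNormDeriv θ T k z ≤ c ↔ ‖fderiv ℝ (iter θ T k z.1) z.2‖ ≤ Real.exp c := by
  have h : (c : EReal) = ENNReal.log (ENNReal.ofReal (Real.exp c)) := by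
    rw [ENNReal.log_ofReal_of_pos (Real.exp_pos c), Real.log_exp]
  rw [h, logNormDeriv, ENNReal.log_le_log_iff, ← ofReal_norm,
    ENNReal.ofReal_le_ofReal_iff (Real.exp_pos c).le]

lemma coe_truncLogDeriv (m k : ℕ) (z : Ω × EuclideanSpace ℝ (Fin d)) :
    (truncLogDeriv θ T m k z : EReal) =
      max (logNormDeriv θ T k z) ((-((k : ℝ) * m) : ℝ) : EReal) := by
  refine le_antisymm ?_ (max_le ?_ ?_)
  · rcases eq_or_ne ‖fderiv ℝ (iter θ T k z.1) z.2‖ 0 with h | h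
    · refine le_max_of_le_right (EReal.coe_le_coe_iff.2 (truncLogDeriv_le_iff.2 ⟨?_, le_rfl⟩))
      rw [h]; exact (Real.exp_pos _).le
    · have hpos : 0 < ‖fderiv ℝ (iter θ T k z.1) z.2‖ := lt_of_le_of_ne (norm_nonneg _) h.symm
      have h1 : logNormDeriv θ T k z = Real.log ‖fderiv ℝ (iter θ T k z.1) z.2‖ := by
        rw [logNormDeriv, ← ofReal_norm, ENNReal.log_ofReal_of_pos hpos]
      rw [h1, ← EReal.coe_strictMono.monotone.map_max]
      refine EReal.coe_le_coe_iff.2 (truncLogDeriv_le_iff.2 ⟨?_, le_max_right _ _⟩)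
      refine (Real.exp_log hpos).ge.trans (Real.exp_le_exp.2 (le_max_left _ _))
  · exact logNormDeriv_le_coe_iff.2 (norm_fderiv_le_exp_truncLogDeriv m k z)
  · exact EReal.coe_le_coe_iff.2 (neg_mul_le_truncLogDeriv m k z)

/-- With `m = 0` the cut-off is at zero, so the truncation is `log⁺`. -/
lemma toENNReal_logNormDeriv (k : ℕ) (z : Ω × EuclideanSpace ℝ (Fin d)) :
    (logNormDeriv θ T k z).toENNReal = ENNReal.ofReal (truncLogDeriv θ T 0 k z) := by
  have h := coe_truncLogDeriv (θ := θ) (T := T) 0 k z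
  rw [Nat.cast_zero, mul_zero, neg_zero, EReal.coe_zero] at h
  have h1 : ENNReal.ofReal (truncLogDeriv θ T 0 k z) =
      (truncLogDeriv θ T 0 k z : EReal).toENNReal := by
    rw [EReal.toENNReal_of_ne_top (EReal.coe_ne_top _), EReal.toReal_coe]
  rw [h1, h]
  rcases le_total (logNormDeriv θ T k z) 0 with h0 | h0
  · rw [max_eq_right h0, EReal.toENNReal_of_nonpos h0, EReal.toENNReal_zero]
  · rw [max_eq_left h0]

lemma continuous_truncLogDeriv (hT : ∀ ω, ContDiff ℝ 1 (T ω)) (m k : ℕ) (ω : Ω) :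
    Continuous fun x => truncLogDeriv θ T m k (ω, x) := by
  refine Continuous.log ?_ fun x => (lt_max_of_lt_right (Real.exp_pos _)).ne'
  exact (((contDiff_iter hT k ω).continuous_fderiv one_ne_zero).norm).max continuous_const

variable [MeasurableSpace Ω]

lemma IsRandomC1.measurable_skew (hT : IsRandomC1 T) (hθ : Measurable θ) :
    Measurable (skew θ T) := by
  have h := measurable_uncurry_of_continuous_of_measurable (u := fun x ω => T ω x)
    (fun ω => (hT.contDiff ω).continuous) hT.measurable
  exact (hθ.comp measurable_fst).prodMk (h.comp measurable_swap)

lemma IsRandomC1.measurable_iter (hT : IsRandomC1 T) (hθ : Measurable θ) (n : ℕ)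
    (x : EuclideanSpace ℝ (Fin d)) : Measurable fun ω => iter θ T n ω x := by
  have h := ((hT.measurable_skew hθ).iterate n).snd.comp
    (measurable_id.prodMk (measurable_const (a := x)))
  convert h using 1
  ext1 ω
  simp [iterate_skew]

lemma measurable_truncLogDeriv (hT : IsRandomC1 T) (hθ : Measurable θ) (m k : ℕ) :
    Measurable (truncLogDeriv θ T m k) := by
  have h1 : ∀ x, Measurable fun ω => ‖fderiv ℝ (iter θ T k ω) x‖ := fun x =>
    measurable_norm_fderiv (fun ω => (contDiff_iter hT.contDiff k ω).differentiable one_ne_zero x)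
      (hT.measurable_iter hθ k)
  have h2 : ∀ x, Measurable fun ω => truncLogDeriv θ T m k (ω, x) := fun x =>
    ((h1 x).max measurable_const).log
  have h3 : Measurable (Function.uncurry fun x ω => truncLogDeriv θ T m k (ω, x)) :=
    measurable_uncurry_of_continuous_of_measurable (continuous_truncLogDeriv hT.contDiff m k) h2
  have h4 := h3.comp measurable_swap
  exact h4

variable {P : Measure Ω} [IsProbabilityMeasure P] {K : Set (Ω × EuclideanSpace ℝ (Fin d))}

/-- The integrability hypothesis controls one step. By subadditivity `log⁺ ‖DT^k‖` is at most the
sum of the one-step terms along the orbit, whose bounds are integrable since `P` and `K` are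
invariant. The lower cut-off adds at most the constant `k m`. -/
lemma truncLogDeriv_mem_testFunctions (hθ : MeasurePreserving θ P P) (hT : IsRandomC1 T)
    (hK : IsRandomCompact K) (hinv : IsInvariant P θ T K)
    (hint : ∫⁻ ω, ⨆ x ∈ fibre K ω, (logNormDeriv θ T 1 (ω, x)).toENNReal ∂P < ⊤) (m k : ℕ) :
    truncLogDeriv θ T m k ∈ testFunctions P K := by
  have hm := measurable_truncLogDeriv hT hθ.measurable
  have hc := continuous_truncLogDeriv (θ := θ) hT.contDiff
  have hnonneg : ∀ k z, 0 ≤ truncLogDeriv θ T 0 k z := fun k z => by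
    simpa using neg_mul_le_truncLogDeriv (θ := θ) (T := T) 0 k z
  have hone : truncLogDeriv θ T 0 1 ∈ testFunctions P K := by
    let s : Ω → ℝ≥0∞ := fun ω => ⨆ x ∈ fibre K ω, (logNormDeriv θ T 1 (ω, x)).toENNReal
    -- On an empty fibre the supremum is `0` in `ℝ≥0∞` but `-∞` in `EReal`; `toENNReal` reconciles
    -- the two.
    have hs : Measurable s := by
      have h := (measurable_iSup_fibre hK
        (F := fun ω x => ((ENNReal.ofReal (truncLogDeriv θ T 0 1 (ω, x)) : ℝ≥0∞) : EReal))
        (fun ω => continuous_coe_ennreal_ereal.comp (ENNReal.continuous_ofReal.comp (hc 0 1 ω)))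
        (fun x => ((hm 0 1).comp (measurable_id.prodMk
          measurable_const)).ennreal_ofReal.coe_ereal_ennreal)).ereal_toENNReal
      convert h using 1
      ext1 ω
      refine le_antisymm (iSup₂_le fun x hx => ?_) ?_
      · rw [toENNReal_logNormDeriv, ← EReal.coe_ennreal_le_coe_ennreal_iff,
          EReal.coe_toENNReal]
        · exact le_iSup₂ (f := fun x (_ : x ∈ fibre K ω) =>
            ((ENNReal.ofReal (truncLogDeriv θ T 0 1 (ω, x)) : ℝ≥0∞) : EReal)) x hx
        · exact (EReal.coe_ennreal_nonneg _).trans (le_iSup₂ (f := fun x (_ : x ∈ fibre K ω) =>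
            ((ENNReal.ofReal (truncLogDeriv θ T 0 1 (ω, x)) : ℝ≥0∞) : EReal)) x hx)
      · rw [← EReal.toENNReal_coe (x := s ω)]
        refine EReal.toENNReal_le_toENNReal (iSup₂_le fun x hx => ?_)
        rw [EReal.coe_ennreal_le_coe_ennreal_iff, ← toENNReal_logNormDeriv]
        exact le_iSup₂ (f := fun x (_ : x ∈ fibre K ω) =>
          (logNormDeriv θ T 1 (ω, x)).toENNReal) x hx
    refine ⟨hm 0 1, hc 0 1, fun ω => (s ω).toReal,
      integrable_toReal_of_lintegral_ne_top hs.aemeasurable hint.ne, ?_⟩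
    filter_upwards [ae_lt_top hs hint.ne] with ω hω x hx
    rw [abs_of_nonneg (hnonneg _ _), ← ENNReal.ofReal_le_iff_le_toReal hω.ne,
      ← toENNReal_logNormDeriv]
    exact le_iSup₂ (f := fun x (_ : x ∈ fibre K ω) => (logNormDeriv θ T 1 (ω, x)).toENNReal) x hx
  have hzero : ∀ k, truncLogDeriv θ T 0 k ∈ testFunctions P K := by
    intro k
    induction k with
    | zero =>
      refine mem_testFunctions_of_bounded (c := 0) (hm 0 0) (hc 0 0) fun z => ?_
      rw [abs_of_nonneg (hnonneg _ _)]
      refine truncLogDeriv_le_iff.2 ⟨?_, by simp⟩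
      have : iter θ T 0 z.1 = id := rfl
      rw [this, fderiv_id, Real.exp_zero]
      exact ContinuousLinearMap.norm_id_le
    | succ k ih =>
      refine mem_testFunctions_of_abs_le (hm 0 (k + 1)) (hc 0 (k + 1))
        (Submodule.add_mem _ ih (iterate_comp_mem_testFunctions hθ hinv
          (hT.measurable_skew hθ.measurable) (fun ω => (hT.contDiff ω).continuous) hone k))
        (ae_of_all _ fun ω x _ => ?_)
      refine abs_le_abs_of_nonneg (hnonneg _ _) ?_
      exact truncLogDeriv_add_le hT.contDiff 0 k 1 (ω, x)
  refine mem_testFunctions_of_abs_le (hm m k) (hc m k) (Submodule.add_mem _ (hzero k)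
    (Submodule.smul_mem _ ((k : ℝ) * m) one_mem_testFunctions)) (ae_of_all _ fun ω x _ => ?_)
  have h1 := neg_mul_le_truncLogDeriv (θ := θ) (T := T) m k (ω, x)
  have h2 := truncLogDeriv_anti (θ := θ) (T := T) (Nat.zero_le m) k (ω, x)
  have h3 := hnonneg k (ω, x)
  have h4 : (0 : ℝ) ≤ k * m := by positivity
  simp only [Pi.add_apply, Pi.smul_apply, Pi.one_apply, smul_eq_mul, mul_one]
  rw [abs_of_nonneg (add_nonneg h3 h4), abs_le]
  constructor <;> linarith

end Derivative

/-! ### From a negative mean supremum to contraction of close points. -/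

section Contraction

open Set Filter Topology

variable {Ω : Type*} {d : ℕ} {θ : Ω → Ω}
  {T : Ω → EuclideanSpace ℝ (Fin d) → EuclideanSpace ℝ (Fin d)}
  {K : Set (Ω × EuclideanSpace ℝ (Fin d))}

/-- The mean value inequality is used on a ball about `z ∈ A`, which is convex even though the
thickening need not be. -/
lemma dist_image_le_of_norm_fderiv_le {E : Type*} [NormedAddCommGroup E] [NormedSpace ℝ E]
    {g : E → E} (hg : Differentiable ℝ g) {A : Set E} {r c : ℝ}
    (hc : ∀ x ∈ Metric.thickening r A, ‖fderiv ℝ g x‖ ≤ c) {x z : E} (hz : z ∈ A)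
    (hx : dist x z < r) : dist (g x) (g z) ≤ c * dist x z := by
  have hsub : Metric.ball z r ⊆ Metric.thickening r A := fun y hy =>
    Metric.mem_thickening_iff.2 ⟨z, hz, hy⟩
  rw [dist_eq_norm, dist_eq_norm]
  refine (convex_ball z r).norm_image_sub_le_of_norm_fderiv_le (fun y _ => hg y)
    (fun y hy => hc y (hsub hy)) (Metric.mem_ball_self (dist_nonneg.trans_lt hx)) hx

/-- Distances grow at most by `C` per step, so a point starting within `r / C ^ k` of a point of
`K(ω)` stays within `r` of its orbit up to time `k`, where the one-step bound applies. -/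
lemma norm_fderiv_iter_le_pow (hT : ∀ ω, ContDiff ℝ 1 (T ω)) {r C : ℝ} (hC : 1 ≤ C)
    (hb : ∀ ω, ∀ x ∈ Metric.thickening r (fibre K ω), ‖fderiv ℝ (T ω) x‖ ≤ C) {k : ℕ}
    {ω : Ω} (hω : ∀ n, iter θ T n ω '' fibre K ω = fibre K (θ^[n] ω))
    {x : EuclideanSpace ℝ (Fin d)} (hx : x ∈ Metric.thickening (r / C ^ k) (fibre K ω)) :
    ‖fderiv ℝ (iter θ T k ω) x‖ ≤ C ^ k := by
  obtain ⟨z, hz, hxz⟩ := Metric.mem_thickening_iff.1 hx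
  have hC0 : 0 < C := zero_lt_one.trans_le hC
  have hzj : ∀ j, iter θ T j ω z ∈ fibre K (θ^[j] ω) := fun j => hω j ▸ mem_image_of_mem _ hz
  have hlt : ∀ j ≤ k, C ^ j * dist x z < r := fun j hj => by
    rw [lt_div_iff₀ (by positivity)] at hxz
    calc C ^ j * dist x z ≤ C ^ k * dist x z := by gcongr
      _ < r := by rwa [mul_comm]
  have hdist : ∀ j ≤ k, dist (iter θ T j ω x) (iter θ T j ω z) ≤ C ^ j * dist x z := by
    intro j
    induction j with
    | zero => simp [iter]
    | succ j ih =>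
      intro hj
      have h := ih (Nat.le_of_succ_le hj)
      refine (dist_image_le_of_norm_fderiv_le ((hT _).differentiable one_ne_zero) (hb (θ^[j] ω))
        (hzj j) (h.trans_lt (hlt j (Nat.le_of_succ_le hj)))).trans ?_
      rw [pow_succ', mul_assoc]
      gcongr
  have hder : ∀ j ≤ k, ‖fderiv ℝ (iter θ T j ω) x‖ ≤ C ^ j := by
    intro j
    induction j with
    | zero =>
      intro _
      have : iter θ T 0 ω = id := rfl
      rw [this, fderiv_id, pow_zero]
      exact ContinuousLinearMap.norm_id_le
    | succ j ih =>
      intro hj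
      have hj' := Nat.le_of_succ_le hj
      refine (norm_fderiv_iter_add_le hT j 1 ω x).trans ?_
      rw [pow_succ']
      refine mul_le_mul ?_ (ih hj') (norm_nonneg _) hC0.le
      exact hb _ _ (Metric.mem_thickening_iff.2 ⟨_, hzj j, (hdist j hj').trans_lt (hlt j hj')⟩)
  exact hder k le_rfl

variable [MeasurableSpace Ω] {P : Measure Ω} [IsProbabilityMeasure P]

/-- Any fixed `ε`, here `1`, will do: the bound only serves as a dominating function, and negativity
of the mean is recovered by shrinking the neighbourhood. -/
lemma exists_integrable_bound_of_fibrewiseUniform (hK : IsRandomCompact K)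
    (hne : ∀ᵐ ω ∂P, (fibre K ω).Nonempty) (hunif : FibrewiseUniform θ T K) {m k : ℕ} (hk : 1 ≤ k)
    (hmem : truncLogDeriv θ T m k ∈ testFunctions P K) :
    ∃ ρ : ℝ, 0 < ρ ∧ ∃ h : Ω → ℝ, Integrable h P ∧
      ∀ᵐ ω ∂P, ∀ x ∈ Metric.thickening ρ (fibre K ω), truncLogDeriv θ T m k (ω, x) ≤ h ω := by
  obtain ⟨r, hr, hrω⟩ := hunif k hk 1 one_pos
  refine ⟨r, hr, fun ω => supOn (fibre K) (truncLogDeriv θ T m k) ω + 1,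
    (integrable_supOn_fibre hK hne hmem).add (integrable_const 1), ?_⟩
  filter_upwards [hne] with ω hω x hx
  obtain ⟨y, hy, he, hmax⟩ := exists_supOn_eq (hK.isCompact ω) hω (hmem.2.1 ω)
  refine truncLogDeriv_le_iff.2 ⟨logNormDeriv_le_coe_iff.1 ?_, ?_⟩
  · refine (le_iSup₂ (f := fun x (_ : x ∈ Metric.thickening r (fibre K ω)) =>
      logNormDeriv θ T k (ω, x)) x hx).trans ((hrω ω).trans ?_)
    rw [EReal.coe_add]
    gcongr
    rw [coe_supOn hω hmax]
    refine iSup₂_mono fun y _ => ?_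
    rw [coe_truncLogDeriv]
    exact le_max_left _ _
  · rw [he]
    linarith [neg_mul_le_truncLogDeriv (θ := θ) (T := T) m k (ω, y)]

/-- The one-step condition bounds `‖DT_ω‖` by a constant on a uniform neighbourhood, and this
constant controls all iterates on smaller ones. -/
lemma exists_integrable_bound_of_globalUniform (hθ : MeasurePreserving θ P P)
    (hT : ∀ ω, ContDiff ℝ 1 (T ω)) (hinv : IsInvariant P θ T K) (hunif : GlobalUniform θ T K)
    (hbdd : (⨆ ω, ⨆ x ∈ fibre K ω, logNormDeriv θ T 1 (ω, x)) < ⊤) (m k : ℕ) :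
    ∃ ρ : ℝ, 0 < ρ ∧ ∃ h : Ω → ℝ, Integrable h P ∧
      ∀ᵐ ω ∂P, ∀ x ∈ Metric.thickening ρ (fibre K ω), truncLogDeriv θ T m k (ω, x) ≤ h ω := by
  obtain ⟨r, hr, hrω⟩ := hunif 1 le_rfl 1 one_pos
  obtain ⟨c, hc, -⟩ := EReal.lt_iff_exists_real_btwn.1 hbdd
  set c' := max (c + 1) 0
  have hb : ∀ ω, ∀ x ∈ Metric.thickening r (fibre K ω), ‖fderiv ℝ (T ω) x‖ ≤ Real.exp c' := by
    intro ω x hx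
    refine logNormDeriv_le_coe_iff (θ := θ) (k := 1) (z := (ω, x)).1 ?_
    calc logNormDeriv θ T 1 (ω, x)
        ≤ ⨆ ω, ⨆ x ∈ Metric.thickening r (fibre K ω), logNormDeriv θ T 1 (ω, x) :=
          le_iSup_of_le ω (le_iSup₂ (f := fun x (_ : x ∈ Metric.thickening r (fibre K ω)) =>
            logNormDeriv θ T 1 (ω, x)) x hx)
      _ ≤ _ := hrω
      _ ≤ (c : EReal) + (1 : ℝ) := by gcongr
      _ = ((c + 1 : ℝ) : EReal) := (EReal.coe_add _ _).symm
      _ ≤ c' := EReal.coe_le_coe_iff.2 (le_max_left _ _)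
  have hC : 1 ≤ Real.exp c' := Real.one_le_exp (le_max_right _ _)
  refine ⟨r / Real.exp c' ^ k, by positivity, fun _ => k * c', integrable_const _, ?_⟩
  filter_upwards [hinv.ae_iter_image hθ] with ω hω x hx
  refine truncLogDeriv_le_iff.2 ⟨?_, ?_⟩
  · rw [Real.exp_nat_mul]
    exact norm_fderiv_iter_le_pow hT hC hb hω hx
  · have h1 : (0 : ℝ) ≤ k * c' := mul_nonneg k.cast_nonneg (le_max_right _ _)
    have h2 : (0 : ℝ) ≤ k * m := by positivity
    linarith

/-- If the suprema over `K(ω)` of a function have negative mean, then so do the suprema over small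
neighbourhoods of `K(ω)`, as soon as they have an integrable bound. -/
lemma exists_thickening_bound (hK : IsRandomCompact K) (hne : ∀ᵐ ω ∂P, (fibre K ω).Nonempty)
    {f : Ω × EuclideanSpace ℝ (Fin d) → ℝ} (hf : f ∈ testFunctions P K) {b : ℝ}
    (hb : ∀ z, b ≤ f z) (hneg : meanSup P K f < 0) {ρ : ℝ} (hρ : 0 < ρ) {h : Ω → ℝ}
    (hh : Integrable h P) (hfh : ∀ᵐ ω ∂P, ∀ x ∈ Metric.thickening ρ (fibre K ω), f (ω, x) ≤ h ω) :
    ∃ r : ℝ, 0 < r ∧ ∃ G : Ω → ℝ, Measurable G ∧ Integrable G P ∧ ∫ ω, G ω ∂P < 0 ∧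
      ∀ᵐ ω ∂P, ∀ x ∈ Metric.thickening r (fibre K ω), f (ω, x) ≤ G ω := by
  let A : ℕ → Ω → Set (EuclideanSpace ℝ (Fin d)) := fun n ω =>
    Metric.thickening (1 / ((n : ℝ) + 1)) (fibre K ω)
  have hGm : ∀ n, Measurable (supOn (A n) f) := fun n =>
    (measurable_iSup_thickening hK (F := fun ω x => (f (ω, x) : EReal))
      (fun ω => continuous_coe_real_ereal.comp (hf.2.1 ω))
      (fun x => (hf.1.comp (measurable_id.prodMk measurable_const)).coe_real_ereal) _).ereal_toReal
  have hsmall : ∀ᶠ n : ℕ in atTop, 1 / ((n : ℝ) + 1) < ρ :=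
    tendsto_one_div_add_atTop_nhds_zero_nat.eventually_lt_const hρ
  have hbound : ∀ n : ℕ, 1 / ((n : ℝ) + 1) < ρ → ∀ᵐ ω ∂P, ∀ x ∈ A n ω, f (ω, x) ≤ h ω := by
    intro n hn
    filter_upwards [hfh] with ω hω x hx
    exact hω x (Metric.thickening_mono hn.le _ hx)
  have hAne : ∀ᵐ ω ∂P, ∀ n, (A n ω).Nonempty := by
    filter_upwards [hne] with ω hω n
    exact hω.mono (Metric.self_subset_thickening Nat.one_div_pos_of_nat _)
  have hdom : ∀ᶠ n : ℕ in atTop, ∀ᵐ ω ∂P, ‖supOn (A n) f ω‖ ≤ |h ω| + |b| := by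
    filter_upwards [hsmall] with n hn
    filter_upwards [hbound n hn, hAne] with ω h1 h2
    have h3 := supOn_le (h2 n) h1
    obtain ⟨x, hx⟩ := h2 n
    have h4 := (hb _).trans (le_supOn h1 hx)
    rw [Real.norm_eq_abs, abs_le]
    have h5 := neg_abs_le b
    have h6 := le_abs_self (h ω)
    have h7 := abs_nonneg (h ω)
    have h8 := abs_nonneg b
    constructor <;> linarith
  -- By compactness the suprema over shrinking neighbourhoods converge to the supremum over the
  -- fibre, so dominated convergence carries the negative mean over to some neighbourhood.
  have hlim : ∀ᵐ ω ∂P, Tendsto (fun n => supOn (A n) f ω) atTop (𝓝 (supOn (fibre K) f ω)) := by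
    filter_upwards [hne] with ω h1
    obtain ⟨y, hy, -, hmax⟩ := exists_supOn_eq (hK.isCompact ω) h1 (hf.2.1 ω)
    have hcoe := coe_supOn h1 hmax
    have h2 : Tendsto (fun n => ⨆ x ∈ A n ω, (f (ω, x) : EReal)) atTop
        (𝓝 (⨆ x ∈ fibre K ω, (f (ω, x) : EReal))) := by
      rw [iSup_eq_iInf_iSup_thickening (F := fun x => (f (ω, x) : EReal))
        (continuous_coe_real_ereal.comp (hf.2.1 ω)) (hK.isCompact ω)]
      refine tendsto_atTop_iInf fun i j hij => ?_
      exact biSup_mono fun x hx => Metric.thickening_mono (Nat.one_div_le_one_div hij) _ hx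
    refine (EReal.tendsto_toReal ?_ ?_).comp h2
    · rw [← hcoe]; exact EReal.coe_ne_top _
    · rw [← hcoe]; exact EReal.coe_ne_bot _
  have hint := tendsto_integral_filter_of_dominated_convergence (fun ω => |h ω| + |b|)
    (Eventually.of_forall fun n => (hGm n).aestronglyMeasurable) hdom
    (hh.abs.add (integrable_const _)) hlim
  obtain ⟨n, ⟨hn1, hn2⟩, hn3⟩ := ((hsmall.and hdom).and (hint.eventually_lt_const hneg)).exists
  refine ⟨1 / ((n : ℝ) + 1), Nat.one_div_pos_of_nat, supOn (A n) f, hGm n,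
    (hh.abs.add (integrable_const _)).mono' (hGm n).aestronglyMeasurable hn2, hn3, ?_⟩
  filter_upwards [hbound n hn1] with ω h1 x hx
  exact le_supOn h1 hx

/-- If `log ‖D T_ω^k‖` has a bound of negative mean on uniform neighbourhoods of the fibres of `K`,
then the fibres of `K` are not almost surely infinite. -/
lemma exists_not_ae_le_encard_of_bound (hθ : MeasurePreserving θ P P)
    (hT : ∀ ω, ContDiff ℝ 1 (T ω)) (hK : IsRandomCompact K) (hinv : IsInvariant P θ T K) {k : ℕ}
    {r : ℝ} (hr : 0 < r) {G : Ω → ℝ} (hGm : Measurable G) (hG : Integrable G P)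
    (hneg : ∫ ω, G ω ∂P < 0)
    (hbound : ∀ᵐ ω ∂P, ∀ x ∈ Metric.thickening r (fibre K ω),
      ‖fderiv ℝ (iter θ T k ω) x‖ ≤ Real.exp (G ω)) :
    ∃ N : ℕ, ¬ ∀ᵐ ω ∂P, (N : ℕ∞) ≤ (fibre K ω).encard := by
  -- Half of the negative mean is reserved: nonpositive Birkhoff sums of `G + ε` mean sums of `G` at
  -- most `-nε`, which is a contraction rate.
  obtain ⟨ε, hε, hGε⟩ : ∃ ε : ℝ, 0 < ε ∧ ∫ ω, (G ω + ε) ∂P < 0 := by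
    refine ⟨-(∫ ω, G ω ∂P) / 2, by linarith, ?_⟩
    rw [integral_add hG (integrable_const _), integral_const]
    simp only [probReal_univ, smul_eq_mul, one_mul]
    linarith
  have hpos := measure_birkhoffSum_nonpos_pos (hθ.iterate k) (hGm.add_const ε)
    (hG.add (integrable_const ε)) hGε
  let full : Set Ω := {ω | (∀ n, iter θ T n ω '' fibre K ω = fibre K (θ^[n] ω)) ∧
    ∀ n, ∀ x ∈ Metric.thickening r (fibre K (θ^[n] ω)),
      ‖fderiv ℝ (iter θ T k (θ^[n] ω)) x‖ ≤ Real.exp (G (θ^[n] ω))}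
  have hfull : ∀ᵐ ω ∂P, ω ∈ full :=
    (hinv.ae_iter_image hθ).and
      (ae_all_iff.2 fun n => (hθ.iterate n).quasiMeasurePreserving.ae hbound)
  let A : Set Ω := {ω | ∀ n, birkhoffSum θ^[k] (fun ω => G ω + ε) n ω ≤ 0} ∩ full
  have hA : P A ≠ 0 := by
    have : P A = _ := measure_inter_conull (t := full) hfull
    rw [this]
    exact hpos.ne'
  have hc : Tendsto (fun n : ℕ => Real.exp (-(n * ε)) * r) atTop (𝓝 0) := by
    have h1 : Tendsto (fun n : ℕ => (n : ℝ) * ε) atTop atTop :=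
      tendsto_natCast_atTop_atTop.atTop_mul_const hε
    simpa using (Real.tendsto_exp_neg_atTop_nhds_zero.comp h1).mul_const r
  refine exists_not_ae_le_encard hK (σ := fun n => θ^[k * n]) (fun n => hθ.iterate _) hA hr hc
    (F := fun n ω => iter θ T (k * n) ω) (fun ω hω n => (hω.2.1 (k * n)).symm) ?_
  rintro ω ⟨hω, himg, hder⟩ n x hx y hy hxy
  have hsum : ∀ n, birkhoffSum θ^[k] G n ω ≤ -(n * ε) := by
    intro n
    have h1 := hω n
    simp only [birkhoffSum, Finset.sum_add_distrib, Finset.sum_const, Finset.card_range,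
      nsmul_eq_mul] at h1 ⊢
    linarith
  -- Since the Birkhoff sums are nonpositive, the distance never exceeds its initial value, so the
  -- pair stays within the radius `r` where the next derivative bound is valid.
  have hdist : ∀ n, dist (iter θ T (k * n) ω x) (iter θ T (k * n) ω y) ≤
      Real.exp (birkhoffSum θ^[k] G n ω) * dist x y := by
    intro n
    induction n with
    | zero => simp [iter]
    | succ n ih =>
      rw [Nat.mul_succ, iter_add, iter_add, birkhoffSum_succ, ← Function.iterate_mul]
      have hmem : iter θ T (k * n) ω y ∈ fibre K (θ^[k * n] ω) := himg _ ▸ mem_image_of_mem _ hy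
      have hlt : dist (iter θ T (k * n) ω x) (iter θ T (k * n) ω y) < r := by
        refine ih.trans_lt (lt_of_le_of_lt (mul_le_of_le_one_left dist_nonneg ?_) hxy)
        have h0 : (0 : ℝ) ≤ n * ε := by positivity
        exact Real.exp_le_one_iff.2 ((hsum n).trans (by linarith))
      refine (dist_image_le_of_norm_fderiv_le
        ((contDiff_iter hT k _).differentiable one_ne_zero) (hder (k * n)) hmem hlt).trans ?_
      rw [add_comm, Real.exp_add, mul_assoc]
      gcongr
  refine (hdist n).trans (mul_le_mul (Real.exp_le_exp.2 (hsum n)) hxy.le dist_nonneg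
    (Real.exp_pos _).le)

/-- If `meanSup` is negative for some iterate, then the fibres are not almost surely infinite. -/
lemma exists_not_ae_le_encard_of_meanSup_neg (hθ : MeasurePreserving θ P P)
    (hT : ∀ ω, ContDiff ℝ 1 (T ω)) (hK : IsRandomCompact K) (hinv : IsInvariant P θ T K)
    (hne : ∀ᵐ ω ∂P, (fibre K ω).Nonempty) (hunif : UniformDerivativeCondition θ T K) {m k : ℕ}
    (hk : 1 ≤ k) (hmem : truncLogDeriv θ T m k ∈ testFunctions P K)
    (hneg : meanSup P K (truncLogDeriv θ T m k) < 0) :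
    ∃ N : ℕ, ¬ ∀ᵐ ω ∂P, (N : ℕ∞) ≤ (fibre K ω).encard := by
  obtain ⟨ρ, hρ, h, hh, hb⟩ : ∃ ρ : ℝ, 0 < ρ ∧ ∃ h : Ω → ℝ, Integrable h P ∧
      ∀ᵐ ω ∂P, ∀ x ∈ Metric.thickening ρ (fibre K ω), truncLogDeriv θ T m k (ω, x) ≤ h ω := by
    rcases hunif with hunif | ⟨hunif, hbdd⟩
    · exact exists_integrable_bound_of_fibrewiseUniform hK hne hunif hk hmem
    · exact exists_integrable_bound_of_globalUniform hθ hT hinv hunif hbdd m k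
  obtain ⟨r, hr, G, hGm, hG, hGneg, hGb⟩ := exists_thickening_bound hK hne hmem
    (neg_mul_le_truncLogDeriv m k) hneg hρ hh hb
  refine exists_not_ae_le_encard_of_bound hθ hT hK hinv hr hGm hG hGneg ?_ (k := k)
  filter_upwards [hGb] with ω hω x hx
  exact (truncLogDeriv_le_iff.1 (hω x hx)).1

end Contraction

/-! ### Invariant functionals from Hahn–Banach and orbit averages. -/

section Functional

open Set Filter Topology

/-- A pointwise bounded sequence of linear functionals has a limit along an ultrafilter. -/
lemma exists_linearMap_tendsto_hyperfilter {E : Type*} [AddCommGroup E] [Module ℝ E]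
    (V : Submodule ℝ E) (a : ℕ → E →ₗ[ℝ] ℝ) (hb : ∀ f ∈ V, ∃ C, ∀ n, |a n f| ≤ C) :
    ∃ ℓ : E →ₗ[ℝ] ℝ, ∀ f ∈ V, Tendsto (fun n => a n f) (hyperfilter ℕ) (𝓝 (ℓ f)) := by
  have hlim : ∀ f : V, ∃ y, Tendsto (fun n => a n f) (hyperfilter ℕ) (𝓝 y) := by
    rintro ⟨f, hf⟩
    obtain ⟨C, hC⟩ := hb f hf
    obtain ⟨y, -, hy⟩ := (isCompact_Icc (a := -C) (b := C)).ultrafilter_le_nhds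
      ((hyperfilter ℕ).map fun n => a n f)
      (le_principal_iff.2 (Filter.univ_mem' (f := (hyperfilter ℕ : Filter ℕ))
        fun n => abs_le.1 (hC n)))
    exact ⟨y, hy⟩
  choose L hL using hlim
  let ℓ : V →ₗ[ℝ] ℝ :=
    { toFun := L
      map_add' := fun f g => tendsto_nhds_unique (hL (f + g)) (by
        simpa using (hL f).add (hL g))
      map_smul' := fun c f => tendsto_nhds_unique (hL (c • f)) (by
        simpa using (hL f).const_mul c) }
  obtain ⟨g, hg⟩ := LinearMap.exists_extend ℓ
  refine ⟨g, fun f hf => ?_⟩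
  have : g f = L ⟨f, hf⟩ := LinearMap.congr_fun hg ⟨f, hf⟩
  rw [this]
  exact hL ⟨f, hf⟩

variable {X : Type*} {Θ : X → X} {φ : ℕ → X → ℝ}

/-- Sliding the window `p, …, p + k - 1` by one replaces `φ p` by `φ (p + k)`, at a cost of at most
`φ k ∘ Θ^p`. -/
lemma sum_range_subadditive_le (hφ : ∀ i j z, φ (i + j) z ≤ φ i z + φ j (Θ^[i] z)) (k p : ℕ)
    (z : X) : ∑ i ∈ Finset.range k, φ (p + i) z ≤
      ∑ i ∈ Finset.range k, φ i z + ∑ j ∈ Finset.range p, φ k (Θ^[j] z) := by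
  induction p with
  | zero => simp
  | succ p ih =>
    have h1 := Finset.sum_range_succ (fun i => φ (p + i) z) k
    rw [Finset.sum_range_succ'] at h1
    have h2 : ∑ i ∈ Finset.range k, φ (p + (i + 1)) z = ∑ i ∈ Finset.range k, φ (p + 1 + i) z :=
      Finset.sum_congr rfl fun i _ => by rw [add_assoc, add_comm 1 i]
    rw [Finset.sum_range_succ _ p]
    have h3 := hφ p k z
    rw [add_zero] at h1
    linarith

/-- A long time is compared with an orbit sum of `φ k`. Averaging over `k` consecutive times makes
every orbit point occur once, and the number of boundary terms does not depend on `p`. -/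
lemma mul_subadditive_le (hφ : ∀ i j z, φ (i + j) z ≤ φ i z + φ j (Θ^[i] z)) (k p : ℕ) (z : X) :
    k * φ (p + k) z ≤ ∑ i ∈ Finset.range k, (φ i z + φ (k - i) (Θ^[p + i] z)) +
      ∑ j ∈ Finset.range p, φ k (Θ^[j] z) := by
  have h1 : ∑ _i ∈ Finset.range k, φ (p + k) z ≤
      ∑ i ∈ Finset.range k, (φ (p + i) z + φ (k - i) (Θ^[p + i] z)) := by
    refine Finset.sum_le_sum fun i hi => ?_
    have h := hφ (p + i) (k - i) z
    rwa [add_assoc, Nat.add_sub_cancel' (Finset.mem_range.1 hi).le] at h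
  rw [Finset.sum_const, Finset.card_range, nsmul_eq_mul] at h1
  rw [Finset.sum_add_distrib] at h1 ⊢
  linarith [sum_range_subadditive_le hφ k p z]

variable {Ω : Type*} [MeasurableSpace Ω] {M : Type*} {P : Measure Ω} {K : Set (Ω × M)}
  {f : Ω × M → ℝ}

lemma meanSup_zero (hne : ∀ᵐ ω ∂P, (fibre K ω).Nonempty) : meanSup P K 0 = 0 := by
  refine integral_eq_zero_of_ae ?_
  filter_upwards [hne] with ω hω
  exact le_antisymm (supOn_le hω fun x _ => le_rfl) (hω.elim fun x hx =>
    le_supOn (f := 0) (c := 0) (fun y _ => le_rfl) hx)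

variable [MetricSpace M] [MeasurableSpace M] [SecondCountableTopology M] [Nonempty M]

/-- This is the domination on the line spanned by `f` that Hahn–Banach requires; for `c < 0` it
follows from `0 ≤ meanSup f + meanSup (-f)`. -/
lemma mul_meanSup_le (hK : IsRandomCompact K) (hne : ∀ᵐ ω ∂P, (fibre K ω).Nonempty)
    (hf : f ∈ testFunctions P K) (c : ℝ) : c * meanSup P K f ≤ meanSup P K (c • f) := by
  rcases lt_trichotomy c 0 with hc | rfl | hc
  · have h1 := meanSup_add_le hK hne hf (Submodule.neg_mem _ hf)
    have h2 := meanSup_smul hK hne (Submodule.neg_mem _ hf) (neg_pos.2 hc)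
    rw [add_neg_cancel, meanSup_zero hne] at h1
    rw [neg_smul_neg] at h2
    rw [h2]
    nlinarith
  · rw [zero_mul, zero_smul, meanSup_zero hne]
  · exact (meanSup_smul hK hne hf hc).ge

/-- By the Hahn–Banach theorem, `meanSup` is attained by linear functionals. -/
lemma exists_linearMap_le_meanSup (hK : IsRandomCompact K)
    (hne : ∀ᵐ ω ∂P, (fibre K ω).Nonempty) (hf : f ∈ testFunctions P K) :
    ∃ ℓ : (Ω × M → ℝ) →ₗ[ℝ] ℝ, (∀ g ∈ testFunctions P K, ℓ g ≤ meanSup P K g) ∧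
      ℓ f = meanSup P K f := by
  have H : ∀ c : ℝ, c • (⟨f, hf⟩ : testFunctions P K) = 0 →
      RingHom.id ℝ c • meanSup P K f = 0 := by
    intro c hc
    rcases smul_eq_zero.1 hc with rfl | h
    · exact zero_smul _ _
    · have h0 : f = 0 := congrArg Subtype.val h
      rw [h0, meanSup_zero hne, smul_zero]
  let p : testFunctions P K →ₗ.[ℝ] ℝ := LinearPMap.mkSpanSingleton' ⟨f, hf⟩ (meanSup P K f) H
  have hp : ∀ x : p.domain, p x ≤ meanSup P K (x : testFunctions P K) := by
    rintro ⟨x, hx⟩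
    obtain ⟨c, rfl⟩ := Submodule.mem_span_singleton.1 hx
    rw [LinearPMap.mkSpanSingleton'_apply]
    exact mul_meanSup_le hK hne hf c
  obtain ⟨ℓ, hℓp, hℓ⟩ := exists_extension_of_le_sublinear p
    (fun x : testFunctions P K => meanSup P K (x : Ω × M → ℝ))
    (fun c hc x => meanSup_smul hK hne x.2 hc) (fun x y => meanSup_add_le hK hne x.2 y.2) hp
  -- The values off the test functions are irrelevant; a total functional can be composed freely
  -- with the skew product.
  obtain ⟨L, hL⟩ := LinearMap.exists_extend ℓ
  have hLℓ : ∀ g (hg : g ∈ testFunctions P K), L g = ℓ ⟨g, hg⟩ := fun g hg =>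
    LinearMap.congr_fun hL ⟨g, hg⟩
  refine ⟨L, fun g hg => (hLℓ g hg).trans_le (hℓ _), ?_⟩
  have hdom : (⟨f, hf⟩ : testFunctions P K) ∈ p.domain := Submodule.mem_span_singleton_self _
  rw [hLℓ f hf, hℓp ⟨_, hdom⟩]
  exact LinearPMap.mkSpanSingleton'_apply_self _ _ _ _

variable {θ : Ω → Ω} {T : Ω → M → M}

/-- An invariant functional on the test functions, dominated by `meanSup`, on which a subadditive
cocycle with nonnegative `meanSup` is nonnegative. The cocycle may depend on a parameter `m` in
which it is decreasing. -/
lemma exists_invariant_linearMap (hK : IsRandomCompact K)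
    (hne : ∀ᵐ ω ∂P, (fibre K ω).Nonempty) (hθ : MeasurePreserving θ P P)
    (hinv : IsInvariant P θ T K) (hTm : Measurable (skew θ T)) (hTc : ∀ ω, Continuous (T ω))
    {φ : ℕ → ℕ → Ω × M → ℝ} (hφ : ∀ m k, φ m k ∈ testFunctions P K)
    (hanti : ∀ k, Antitone fun m => φ m k)
    (hsub : ∀ m i j z, φ m (i + j) z ≤ φ m i z + φ m j ((skew θ T)^[i] z))
    (hpos : ∀ m k, 1 ≤ k → 0 ≤ meanSup P K (φ m k)) :
    ∃ ℓ : (Ω × M → ℝ) →ₗ[ℝ] ℝ, (∀ f ∈ testFunctions P K, ℓ f ≤ meanSup P K f) ∧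
      (∀ f ∈ testFunctions P K, ℓ (f ∘ skew θ T) = ℓ f) ∧ ∀ m k, 0 ≤ ℓ (φ m k) := by
  -- The diagonal choice serves every `m` at once: for `m ≤ n` monotonicity gives `b n (φ m n) ≥ b n
  -- (φ n n) ≥ 0`.
  choose b hb hbφ using fun n : ℕ => exists_linearMap_le_meanSup hK hne (hφ n n)
  have hcomp : ∀ f ∈ testFunctions P K, ∀ j, f ∘ (skew θ T)^[j] ∈ testFunctions P K :=
    fun f hf j => iterate_comp_mem_testFunctions hθ hinv hTm hTc hf j
  have hble : ∀ n, ∀ f ∈ testFunctions P K, ∀ j, b n (f ∘ (skew θ T)^[j]) ≤ meanSup P K f :=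
    fun n f hf j => (hb n _ (hcomp f hf j)).trans
      (meanSup_comp_iterate_skew hK hθ hinv hTm hTc hf j).le
  have hbge : ∀ n, ∀ f ∈ testFunctions P K, ∀ j,
      -meanSup P K (-f) ≤ b n (f ∘ (skew θ T)^[j]) := by
    intro n f hf j
    have h := hble n (-f) (Submodule.neg_mem _ hf) j
    have h2 : (-f) ∘ (skew θ T)^[j] = -(f ∘ (skew θ T)^[j]) := rfl
    rw [h2, map_neg] at h
    linarith
  have hbmono : ∀ n, ∀ f ∈ testFunctions P K, ∀ g ∈ testFunctions P K, f ≤ g → b n f ≤ b n g := by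
    intro n f hf g hg hfg
    have h := (hb n (f - g) (Submodule.sub_mem _ hf hg)).trans
      (meanSup_mono hK hne (Submodule.sub_mem _ hf hg) (Submodule.zero_mem _)
        (ae_of_all _ fun ω x _ => sub_nonpos.2 (hfg _)))
    rw [map_sub, meanSup_zero hne] at h
    linarith
  let a : ℕ → (Ω × M → ℝ) →ₗ[ℝ] ℝ := fun n =>
    (n : ℝ)⁻¹ • ∑ j ∈ Finset.range n, b n ∘ₗ LinearMap.funLeft ℝ ℝ (skew θ T)^[j]
  have ha : ∀ n f, a n f = (n : ℝ)⁻¹ * ∑ j ∈ Finset.range n, b n (f ∘ (skew θ T)^[j]) := by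
    intro n f
    simp only [a, LinearMap.smul_apply, LinearMap.sum_apply, LinearMap.comp_apply, smul_eq_mul]
    rfl
  have ha_le : ∀ n, 1 ≤ n → ∀ f ∈ testFunctions P K, a n f ≤ meanSup P K f := by
    intro n hn f hf
    have hn' : (0 : ℝ) < n := by exact_mod_cast hn
    rw [ha, inv_mul_le_iff₀ hn']
    refine (Finset.sum_le_sum fun j _ => hble n f hf j).trans ?_
    simp
  have hbdd : ∀ f ∈ testFunctions P K, ∃ C, ∀ n, |a n f| ≤ C := by
    intro f hf
    refine ⟨|meanSup P K f| + |meanSup P K (-f)|, fun n => ?_⟩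
    have h3 := abs_nonneg (meanSup P K f)
    have h4 := abs_nonneg (meanSup P K (-f))
    rcases Nat.eq_zero_or_pos n with rfl | hn
    · rw [ha]; simp only [Nat.cast_zero, inv_zero, zero_mul, abs_zero]; positivity
    · have h1 := ha_le n hn f hf
      have h2 := ha_le n hn (-f) (Submodule.neg_mem _ hf)
      rw [map_neg] at h2
      have h5 := le_abs_self (meanSup P K f)
      have h6 := le_abs_self (meanSup P K (-f))
      rw [abs_le]
      constructor <;> linarith
  obtain ⟨ℓ, hℓ⟩ := exists_linearMap_tendsto_hyperfilter (testFunctions P K) a hbdd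
  have hlarge : ∀ N : ℕ, ∀ᶠ n in (hyperfilter ℕ : Filter ℕ), N ≤ n := fun N =>
    Nat.hyperfilter_le_atTop (eventually_ge_atTop N)
  have hdiv : ∀ C : ℝ, Tendsto (fun n : ℕ => C / n) (hyperfilter ℕ) (𝓝 0) := fun C =>
    (tendsto_const_div_atTop_nhds_zero_nat C).mono_left Nat.hyperfilter_le_atTop
  refine ⟨ℓ, fun f hf => ?_, fun f hf => ?_, fun m k => ?_⟩
  · refine le_of_tendsto (hℓ f hf) ?_
    filter_upwards [hlarge 1] with n hn
    exact ha_le n hn f hf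
  · have hf' : f ∘ skew θ T ∈ testFunctions P K := hcomp f hf 1
    refine sub_eq_zero.1 (tendsto_nhds_unique ((hℓ _ hf').sub (hℓ _ hf)) ?_)
    refine squeeze_zero_norm (fun n => ?_) (hdiv (2 * (|meanSup P K f| + |meanSup P K (-f)|)))
    -- As in the Krylov–Bogoliubov argument, the defect of invariance is two boundary terms divided
    -- by `n`.
    have htel : ∑ j ∈ Finset.range n, b n ((f ∘ skew θ T) ∘ (skew θ T)^[j]) -
        ∑ j ∈ Finset.range n, b n (f ∘ (skew θ T)^[j]) =
        b n (f ∘ (skew θ T)^[n]) - b n (f ∘ (skew θ T)^[0]) := by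
      rw [← Finset.sum_sub_distrib, ← Finset.sum_range_sub fun j => b n (f ∘ (skew θ T)^[j])]
      refine Finset.sum_congr rfl fun j _ => ?_
      rw [Function.iterate_succ', Function.comp_assoc]
    rw [ha, ha, ← mul_sub, htel, Real.norm_eq_abs, abs_mul, abs_inv, Nat.abs_cast, inv_mul_eq_div]
    gcongr
    have h1 := hble n f hf n
    have h2 := hbge n f hf n
    have h3 := hble n f hf 0
    have h4 := hbge n f hf 0
    have h5 := le_abs_self (meanSup P K f)
    have h6 := le_abs_self (meanSup P K (-f))
    rw [abs_le]
    constructor <;> linarith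
  -- `C` collects the boundary terms of `mul_subadditive_le` and the `k` surplus terms of the orbit
  -- average; it does not depend on `n`.
  · set C : ℝ := ∑ i ∈ Finset.range k, (meanSup P K (φ m i) + meanSup P K (φ m (k - i))) +
      k * meanSup P K (-φ m k)
    have hC0 : Tendsto (fun n : ℕ => -(C / n)) (hyperfilter ℕ) (𝓝 0) := by
      simpa using (hdiv C).neg
    refine le_of_tendsto_of_tendsto hC0 (hℓ _ (hφ m k)) ?_
    filter_upwards [hlarge (m + k + 1)] with n hn
    obtain ⟨p, rfl⟩ : ∃ p, n = p + k := ⟨n - k, by omega⟩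
    have hn0 : (0 : ℝ) < ((p + k : ℕ) : ℝ) := by exact_mod_cast (by omega : 0 < p + k)
    have h0 : 0 ≤ b (p + k) (φ m (p + k)) :=
      (hpos (p + k) (p + k) (by omega)).trans ((hbφ (p + k)).symm.le.trans
        (hbmono _ _ (hφ _ _) _ (hφ _ _) (hanti _ (by omega))))
    have hsum : (k : ℝ) • φ m (p + k) ≤
        ∑ i ∈ Finset.range k, (φ m i + φ m (k - i) ∘ (skew θ T)^[p + i]) +
          ∑ j ∈ Finset.range p, φ m k ∘ (skew θ T)^[j] := by
      intro z
      simpa [Finset.sum_apply] using mul_subadditive_le (hsub m) k p z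
    have h1 := hbmono (p + k) _ (Submodule.smul_mem _ _ (hφ m (p + k))) _
      (Submodule.add_mem _ (Submodule.sum_mem _ fun i _ => Submodule.add_mem _ (hφ m i)
        (hcomp _ (hφ m (k - i)) (p + i))) (Submodule.sum_mem _ fun j _ => hcomp _ (hφ m k) j)) hsum
    rw [map_smul, map_add, map_sum, map_sum, smul_eq_mul] at h1
    have h2 : ∑ i ∈ Finset.range k, b (p + k) (φ m i + φ m (k - i) ∘ (skew θ T)^[p + i]) ≤
        ∑ i ∈ Finset.range k, (meanSup P K (φ m i) + meanSup P K (φ m (k - i))) := by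
      refine Finset.sum_le_sum fun i _ => ?_
      rw [map_add]
      exact add_le_add (hb _ _ (hφ m i)) (hble _ _ (hφ m (k - i)) _)
    have h3 : ∑ i ∈ Finset.range k, -meanSup P K (-φ m k) ≤
        ∑ i ∈ Finset.range k, b (p + k) (φ m k ∘ (skew θ T)^[p + i]) :=
      Finset.sum_le_sum fun i _ => hbge _ _ (hφ m k) _
    rw [Finset.sum_const, Finset.card_range, nsmul_eq_mul] at h3
    have h4 : 0 ≤ (k : ℝ) * b (p + k) (φ m (p + k)) := mul_nonneg k.cast_nonneg h0
    rw [ha, Finset.sum_range_add, ← neg_div, div_eq_inv_mul]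
    refine mul_le_mul_of_nonneg_left ?_ (inv_nonneg.2 hn0.le)
    linarith

end Functional

/-! ### Invariant measures on `K` from dominated functionals. -/

section InvariantMeasure

open Set Filter Topology

variable {Ω : Type*} [MeasurableSpace Ω] {M : Type*} [MetricSpace M] [MeasurableSpace M]
  [BorelSpace M] {P : Measure Ω} [IsProbabilityMeasure P] {K : Set (Ω × M)}

/-- Two finite measures on `Ω × M` which integrate the test functions in the same way are equal. -/
lemma eq_of_forall_integral_testFunctions_eq {μ ν : Measure (Ω × M)} [IsFiniteMeasure μ]
    [IsFiniteMeasure ν] (h : ∀ f ∈ testFunctions P K, ∫ z, f z ∂μ = ∫ z, f z ∂ν) : μ = ν := by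
  refine Measure.ext_prod fun {s t} hs ht => ?_
  have key : (μ.restrict (Prod.fst ⁻¹' s)).map Prod.snd =
      (ν.restrict (Prod.fst ⁻¹' s)).map Prod.snd := by
    refine ext_of_forall_integral_eq_of_IsFiniteMeasure fun g => ?_
    have hval : ∀ ρ : Measure (Ω × M), ∫ x, g x ∂(ρ.restrict (Prod.fst ⁻¹' s)).map Prod.snd =
        ∫ z, s.indicator (fun _ => (1 : ℝ)) z.1 * g z.2 ∂ρ := by
      intro ρ
      rw [integral_map measurable_snd.aemeasurable g.continuous.measurable.aestronglyMeasurable,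
        ← integral_indicator (measurable_fst hs)]
      refine integral_congr_ae (ae_of_all _ fun z => ?_)
      by_cases hz : z.1 ∈ s <;> simp [indicator, hz]
    rw [hval, hval]
    exact h _ (indicator_mul_mem_testFunctions hs g.continuous (c := ‖g‖) g.norm_coe_le_norm)
  have hval : ∀ ρ : Measure (Ω × M),
      (ρ.restrict (Prod.fst ⁻¹' s)).map Prod.snd t = ρ (s ×ˢ t) := by
    intro ρ
    rw [Measure.map_apply measurable_snd ht, Measure.restrict_apply (measurable_snd ht), inter_comm]
    rfl
  rw [← hval, ← hval, key]


/-- A measure whose integrals are bounded by `meanSup` has marginal `P`. -/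
lemma map_fst_eq_of_integral_le_meanSup (hK : IsRandomCompact K)
    (hne : ∀ᵐ ω ∂P, (fibre K ω).Nonempty) {μ : Measure (Ω × M)} [IsFiniteMeasure μ]
    (hle : ∀ f ∈ testFunctions P K, ∫ z, f z ∂μ ≤ meanSup P K f) : μ.map Prod.fst = P := by
  ext A hA
  rw [Measure.map_apply measurable_fst hA]
  -- `meanSup` is linear on functions of `ω` alone, so domination for `c = 1` and `c = -1` gives
  -- equality.
  let F : ℝ → Ω × M → ℝ := fun c z => A.indicator (fun _ => (1 : ℝ)) z.1 * c
  have hmem : ∀ c, F c ∈ testFunctions P K := fun c =>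
    indicator_mul_mem_testFunctions hA (g := fun _ => c) continuous_const (c := |c|)
      fun _ => le_rfl
  have hsup : ∀ c, meanSup P K (F c) = P.real A * c := by
    intro c
    rw [← integral_indicator_one hA, ← integral_mul_const]
    refine integral_congr_ae ?_
    filter_upwards [hne] with ω hω
    obtain ⟨x, -, hx, -⟩ := exists_supOn_eq (f := F c) (hK.isCompact ω) hω ((hmem c).2.1 ω)
    rw [hx]
    rfl
  have hint : ∀ c, ∫ z, F c z ∂μ = μ.real (Prod.fst ⁻¹' A) * c := by
    intro c
    rw [integral_mul_const, ← integral_indicator_one (measurable_fst hA)]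
    congr 1
  have h1 := hle _ (hmem 1)
  have h2 := hle _ (hmem (-1))
  rw [hsup, hint] at h1 h2
  rw [← measureReal_eq_measureReal_iff]
  linarith

variable [SecondCountableTopology M] [Nonempty M] {θ : Ω → Ω} {T : Ω → M → M}

/-- A measure whose integrals are bounded by `meanSup` is supported on `K`. -/
lemma measure_compl_eq_zero_of_integral_le_meanSup (hK : IsRandomCompact K)
    (hne : ∀ᵐ ω ∂P, (fibre K ω).Nonempty) {μ : Measure (Ω × M)} [IsFiniteMeasure μ]
    (hle : ∀ f ∈ testFunctions P K, Integrable f μ ∧ ∫ z, f z ∂μ ≤ meanSup P K f) :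
    μ Kᶜ = 0 := by
  -- The truncated distance to the fibre vanishes exactly on `K`. The cap at `1` keeps it positive
  -- over empty fibres, where `toReal` of the distance `∞` would be `0`.
  let f : Ω × M → ℝ := fun z => (min 1 (Metric.infEDist z.2 (fibre K z.1))).toReal
  have hfc : ∀ ω, Continuous fun x => f (ω, x) := fun ω => by
    have h : Continuous fun x => min 1 (Metric.infEDist x (fibre K ω)) :=
      continuous_const.min Metric.continuous_infEDist
    refine continuous_iff_continuousAt.2 fun x => ?_
    exact (ENNReal.continuousAt_toReal (by simp)).comp h.continuousAt
  have hfm : Measurable f := by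
    have h1 : ∀ x, Measurable fun ω => f (ω, x) := fun x =>
      ENNReal.measurable_toReal.comp (measurable_const.min (hK.measurable x))
    have h2 : Measurable (Function.uncurry fun x ω => f (ω, x)) :=
      measurable_uncurry_of_continuous_of_measurable hfc h1
    have h3 := h2.comp measurable_swap
    exact h3
  have hf0 : ∀ z, 0 ≤ f z := fun z => ENNReal.toReal_nonneg
  have hf : f ∈ testFunctions P K := mem_testFunctions_of_bounded (c := 1) hfm hfc fun z => by
    rw [abs_of_nonneg (hf0 z)]
    exact ENNReal.toReal_le_of_le_ofReal zero_le_one (by simp)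
  have hint : ∫ z, f z ∂μ = 0 := by
    refine le_antisymm ((hle f hf).2.trans ?_) (integral_nonneg hf0)
    rw [← meanSup_zero (K := K) hne]
    refine meanSup_mono hK hne hf (Submodule.zero_mem _) (ae_of_all _ fun ω x hx => ?_)
    simp [f, Metric.infEDist_zero_of_mem hx]
  have hae := (integral_eq_zero_iff_of_nonneg hf0 (hle f hf).1).1 hint
  refine measure_mono_null (t := {z | ¬ f z = 0}) ?_ hae
  intro z hz hfz
  have h1 : Metric.infEDist z.2 (fibre K z.1) = 0 := by
    rcases (ENNReal.toReal_eq_zero_iff _).1 hfz with h2 | h2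
    · exact le_zero_iff.1 ((min_le_iff.1 h2.le).resolve_left (by simp))
    · exact absurd h2 (ne_top_of_le_ne_top ENNReal.one_ne_top (min_le_left _ _))
  have h3 : z.2 ∈ fibre K z.1 :=
    (Metric.mem_iff_infEDist_zero_of_closed (hK.isCompact z.1).isClosed).2 h1
  exact hz h3

/-- Invariant functionals bounded by `meanSup` are integrals with respect to invariant measures
on `K`. -/
lemma exists_mem_invariantMeasures (hK : IsRandomCompact K)
    (hne : ∀ᵐ ω ∂P, (fibre K ω).Nonempty) (hθ : MeasurePreserving θ P P)
    (hinv : IsInvariant P θ T K) (hTm : Measurable (skew θ T)) (hTc : ∀ ω, Continuous (T ω))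
    {ℓ : (Ω × M → ℝ) →ₗ[ℝ] ℝ} (hle : ∀ f ∈ testFunctions P K, ℓ f ≤ meanSup P K f)
    (hℓ : ∀ f ∈ testFunctions P K, ℓ (f ∘ skew θ T) = ℓ f) :
    ∃ μ ∈ invariantMeasures P θ T K, ∀ f ∈ testFunctions P K,
      Integrable f μ ∧ ∫ z, f z ∂μ = ℓ f := by
  have hpos : ∀ f ∈ testFunctions P K, 0 ≤ f → 0 ≤ ℓ f := by
    intro f hf h
    have h1 := (hle _ (Submodule.neg_mem _ hf)).trans (meanSup_mono hK hne
      (Submodule.neg_mem _ hf) (Submodule.zero_mem _)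
      (ae_of_all _ fun ω x _ => neg_nonpos.2 (h (ω, x))))
    rw [map_neg, meanSup_zero hne] at h1
    linarith
  obtain ⟨μ, hμfin, hμ⟩ := exists_measure_of_positive_functional (L := testFunctions P K)
    one_mem_testFunctions (fun f hf g hg => sup_mem_testFunctions hf hg) (fun f hf => hf.1)
    prod_le_generateFrom_testFunctions ℓ hpos (fun F hF hanti hlim => by
      refine squeeze_zero (fun n => hpos _ (hF n) fun z => ?_) (fun n => hle _ (hF n))
        (tendsto_meanSup_zero hK hne hF hanti hlim)
      exact Antitone.le_of_tendsto (f := fun n => F n z) (fun i j hij => hanti hij z) (hlim z) n)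
  have hμle : ∀ f ∈ testFunctions P K, Integrable f μ ∧ ∫ z, f z ∂μ ≤ meanSup P K f :=
    fun f hf => ⟨(hμ f hf).1, (hμ f hf).2.trans_le (hle f hf)⟩
  have hfst : μ.map Prod.fst = P :=
    map_fst_eq_of_integral_le_meanSup hK hne fun f hf => (hμle f hf).2
  have hprob : IsProbabilityMeasure μ := ⟨by
    rw [← preimage_univ (f := Prod.fst), ← Measure.map_apply measurable_fst .univ, hfst,
      measure_univ]⟩
  have hmap : μ.map (skew θ T) = μ := by
    refine eq_of_forall_integral_testFunctions_eq (P := P) (K := K) fun f hf => ?_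
    rw [integral_map hTm.aemeasurable hf.1.aestronglyMeasurable, (hμ f hf).2, ← hℓ f hf]
    exact (hμ _ (comp_skew_mem_testFunctions hθ hinv hTm hTc hf)).2
  exact ⟨μ, ⟨hprob, ⟨hTm, hmap⟩, hfst, measure_compl_eq_zero_of_integral_le_meanSup hK hne hμle⟩,
    hμ⟩

end InvariantMeasure

/-! ### Removing the cut-off. -/

section Lyapunov

open Set Filter Topology

variable {Ω : Type*} {d : ℕ} {θ : Ω → Ω}
  {T : Ω → EuclideanSpace ℝ (Fin d) → EuclideanSpace ℝ (Fin d)}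

/-- The cut-off `-k m` tends to `-∞` with `m` because `k ≥ 1`, so the truncations recover the whole
negative part. -/
lemma toENNReal_neg_logNormDeriv_le {k : ℕ} (hk : 1 ≤ k) (z : Ω × EuclideanSpace ℝ (Fin d)) :
    (-logNormDeriv θ T k z).toENNReal ≤ ⨆ m, ENNReal.ofReal (-truncLogDeriv θ T m k z) := by
  have hk0 : (0 : ℝ) < k := by exact_mod_cast hk
  refine le_of_forall_lt fun c hc => ?_
  have hc_top : c ≠ ∞ := hc.ne_top
  obtain ⟨m, hm⟩ := exists_nat_gt (c.toReal / k)
  rw [div_lt_iff₀ hk0] at hm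
  refine lt_of_lt_of_le ?_ (le_iSup _ m)
  rw [ENNReal.lt_ofReal_iff_toReal_lt hc_top, lt_neg, ← EReal.coe_lt_coe_iff, coe_truncLogDeriv,
    max_lt_iff, EReal.coe_lt_coe_iff]
  refine ⟨?_, by linarith⟩
  rw [EReal.coe_neg, ← EReal.lt_neg_comm]
  by_contra! h
  refine absurd hc (not_lt.2 ?_)
  rw [← ENNReal.ofReal_toReal hc_top]
  refine (EReal.toENNReal_le_toENNReal h).trans ?_
  rw [EReal.toENNReal_of_ne_top (EReal.coe_ne_top _), EReal.toReal_coe]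

variable [MeasurableSpace Ω]

/-- For each cut-off the negative part has integral at most that of the positive part, hence at most
that of `log⁺ ‖DT^k‖`, which is finite and independent of `m`. Monotone convergence does the rest.
-/
lemma extIntegral_logNormDeriv_nonneg {μ : Measure (Ω × EuclideanSpace ℝ (Fin d))} {k : ℕ}
    (hint : ∀ m, Integrable (truncLogDeriv θ T m k) μ)
    (hm : ∀ m, Measurable (truncLogDeriv θ T m k)) (hk : 1 ≤ k)
    (hpos : ∀ m, 0 ≤ ∫ z, truncLogDeriv θ T m k z ∂μ) :
    0 ≤ extIntegral μ (logNormDeriv θ T k) := by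
  have htop : ∀ m, ∫⁻ z, ENNReal.ofReal (truncLogDeriv θ T m k z) ∂μ ≠ ∞ := fun m =>
    (hint m).lintegral_lt_top.ne
  have htop' : ∀ m, ∫⁻ z, ENNReal.ofReal (-truncLogDeriv θ T m k z) ∂μ ≠ ∞ := fun m =>
    (hint m).neg.lintegral_lt_top.ne
  have hle : ∫⁻ z, (-logNormDeriv θ T k z).toENNReal ∂μ ≤
      ∫⁻ z, (logNormDeriv θ T k z).toENNReal ∂μ := by
    simp_rw [toENNReal_logNormDeriv]
    refine (lintegral_mono fun z => toENNReal_neg_logNormDeriv_le hk z).trans ?_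
    rw [lintegral_iSup (f := fun m z => ENNReal.ofReal (-truncLogDeriv θ T m k z))
      (fun m => (hm m).neg.ennreal_ofReal) fun i j hij z => ENNReal.ofReal_le_ofReal (neg_le_neg (truncLogDeriv_anti hij k z))]
    refine iSup_le fun m => ?_
    have h := hpos m
    rw [integral_eq_lintegral_pos_part_sub_lintegral_neg_part (hint m), sub_nonneg,
      ENNReal.toReal_le_toReal (htop' m) (htop m)] at h
    exact h.trans (lintegral_mono fun z =>
      ENNReal.ofReal_le_ofReal (truncLogDeriv_anti (Nat.zero_le m) k z))
  have hfin : ((∫⁻ z, (logNormDeriv θ T k z).toENNReal ∂μ : ℝ≥0∞) : EReal) ≠ ⊤ := by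
    simp_rw [toENNReal_logNormDeriv]
    rw [Ne, EReal.coe_ennreal_eq_top_iff]
    exact htop 0
  unfold extIntegral
  rw [EReal.sub_nonneg (Or.inl hfin) (Or.inl (EReal.coe_ennreal_ne_bot _))]
  exact EReal.coe_ennreal_le_coe_ennreal_iff.2 hle

end Lyapunov

end RandomMap

theorem corollary3p2 {Ω : Type*} [MeasurableSpace Ω] (P : Measure Ω) [IsProbabilityMeasure P]
    (θ : Ω ≃ᵐ Ω) (hθ : Ergodic θ P) (d : ℕ)
    (T : Ω → EuclideanSpace ℝ (Fin d) → EuclideanSpace ℝ (Fin d))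
    (hT : RandomMap.IsRandomC1 T)
    (K : Set (Ω × EuclideanSpace ℝ (Fin d)))
    (hK : RandomMap.IsRandomCompact K)
    (hinv : RandomMap.IsInvariant P θ T K)
    (hint : ∫⁻ ω, ⨆ x ∈ RandomMap.fibre K ω, (RandomMap.logNormDeriv θ T 1 (ω, x)).toENNReal ∂P < ⊤)
    (hunif : RandomMap.UniformDerivativeCondition θ T K)
    (hlyap : ∀ μ ∈ RandomMap.invariantMeasures P θ T K, RandomMap.lyapunov θ T μ < 0) :
    ∃ n : ℕ, ∀ᵐ ω ∂P, (RandomMap.fibre K ω).encard = n := by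
  open RandomMap in
  have hθ' : MeasurePreserving θ P P := hθ.toMeasurePreserving
  have hTm := hT.measurable_skew hθ'.measurable
  have hTc : ∀ ω, Continuous (T ω) := fun ω => (hT.contDiff ω).continuous
  suffices h : ∃ N : ℕ, ¬ ∀ᵐ ω ∂P, (N : ℕ∞) ≤ (fibre K ω).encard from
    h.elim fun N hN => exists_ae_encard_eq hθ hK hinv hN
  by_cases hne : ∀ᵐ ω ∂P, (fibre K ω).Nonempty
  swap
  -- If fibres are not almost surely nonempty, then `N = 1` already works.
  · exact ⟨1, by simpa [Set.one_le_encard_iff_nonempty] using hne⟩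
  have hmem := truncLogDeriv_mem_testFunctions hθ' hT hK hinv hint
  by_cases hneg : ∃ m k, 1 ≤ k ∧ meanSup P K (truncLogDeriv θ T m k) < 0
  · obtain ⟨m, k, hk, h⟩ := hneg
    exact exists_not_ae_le_encard_of_meanSup_neg hθ' hT.contDiff hK hinv hne hunif hk (hmem m k) h
  push Not at hneg
  obtain ⟨ℓ, hle, hℓ, hℓpos⟩ := exists_invariant_linearMap hK hne hθ' hinv hTm hTc hmem
    (fun k _ _ h z => truncLogDeriv_anti h k z) (truncLogDeriv_add_le hT.contDiff) hneg
  obtain ⟨μ, hμ, hμℓ⟩ := exists_mem_invariantMeasures hK hne hθ' hinv hTm hTc hle hℓ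
  refine absurd (hlyap μ hμ) (not_lt.2 (le_iInf₂ fun k hk => EReal.div_nonneg ?_ ?_))
  · exact extIntegral_logNormDeriv_nonneg (fun m => (hμℓ _ (hmem m k)).1)
      (fun m => (hmem m k).1) hk fun m => (hℓpos m k).trans_eq (hμℓ _ (hmem m k)).2.symm
  · exact_mod_cast k.cast_nonneg
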